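/- Let $G$ be a finite abelian group isomorphic to $\mathbb Z_{p^2}$, to $\mathbb Z_p\times\mathbb Z_p$, or to $\mathbb Z_p\times\mathbb Z_q$, where $p$ and $q$ are distinct prime numbers and $\mathbb Z_n=\mathbb Z/n\mathbb Z$. Let $\widehat G$ be the group of characters of $G$. For $f:G\to\mathbb C$ and $\chi\in\widehat G$ put $\widehat f(\chi)=\sum_{x\in G}f(x)\chi(-x)$. For $1\le k\le |G|$ let $$\theta(k,G)=\min\bigl\{\,|\operatorname{supp}\widehat f|\ :\ f:G\to\mathbb C,\ f\neq 0,\ |\operatorname{supp} f|\le k\,\bigr\}.$$ Let $A\subset G$ and $B\subset\widehat G$ with $|A|=k\ge 1$ and $|B|=\theta(k,G)$, and consider the matrix $M=(\chi(x))_{\chi\in\widehat G\setminus B,\ x\in A}$, which has $k$ columns. If $M$ does not have full column rank, that is, if $\operatorname{rank}M\ne k$, then $\operatorname{rank} M=k-1$, and $M$ may be decomposed into $k-1$ extracted matrices of rank one: there are subsets $I_1,\dots,I_{k-1}$ of $\widehat G\setminus B$ and $J_1,\dots,J_{k-1}$ of $A$ such that $(\widehat G\setminus B)\times A$ is the disjoint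 union of the products $I_\ell\times J_\ell$ and each matrix $(\chi(x))_{\chi\in I_\ell,\ x\in J_\ell}$ has rank one. -/

import Mathlib

/-- The Fourier transform `f̂(χ) = ∑ₓ f(x) χ(-x)` of a function on a finite abelian group `G`;
the dual group of `G` is `AddChar G ℂ`. -/
noncomputable def fourierTransform {G : Type*} [AddCommGroup G] [Fintype G]
    (f : G → ℂ) (χ : AddChar G ℂ) : ℂ :=
  ∑ x : G, f x * χ (-x)

/-- `E(k, l)`: the functions `f` on `G` with `|supp f| ≤ k` and `|supp f̂| = l`. -/
def supportSpectrumSet (G : Type*) [AddCommGroup G] [Fintype G] (k l : ℕ) : Set (G → ℂ) :=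
  {f | (Function.support f).ncard ≤ k ∧ (Function.support (fourierTransform f)).ncard = l}

/-- Meshulam's function `θ(k, G)`: the least positive `l` such that `E(k, l)` contains a nonzero
function. For `1 ≤ k` such `l` exist, see `meshulamTheta_spec`. -/
noncomputable def meshulamTheta (k : ℕ) (G : Type*) [AddCommGroup G] [Fintype G] : ℕ :=
  sInf {l | 0 < l ∧ ∃ f ∈ supportSpectrumSet G k l, f ≠ 0}

/-- The infimum that defines `θ(k, G)` is attained for every `k ≥ 1`. -/
theorem meshulamTheta_spec (k : ℕ) (hk : 1 ≤ k) (G : Type*) [AddCommGroup G] [Fintype G] :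
    0 < meshulamTheta k G ∧ ∃ f ∈ supportSpectrumSet G k (meshulamTheta k G), f ≠ 0 := by
  classical
  refine Nat.sInf_mem (s := {l | 0 < l ∧ ∃ f ∈ supportSpectrumSet G k l, f ≠ 0}) ?_
  have hft : ∀ χ : AddChar G ℂ, fourierTransform (Pi.single (0 : G) (1 : ℂ)) χ = 1 := by
    intro χ
    simp [fourierTransform, Pi.single_apply]
  refine ⟨_, ?_, Pi.single (0 : G) (1 : ℂ), ⟨?_, rfl⟩, ?_⟩
  · rw [Set.ncard_pos (Set.toFinite _)]
    exact ⟨0, by simp [hft]⟩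
  · refine le_trans ?_ hk
    rw [← Set.ncard_singleton (0 : G)]
    exact Set.ncard_le_ncard (Pi.support_single_subset) (Set.toFinite _)
  · intro h
    simpa using congrFun h 0

/-- The matrix `M_{A,B} = (χ(x))` with rows indexed by the characters `χ ∉ B` and columns indexed
by the points `x ∈ A`, extracted from the Fourier matrix of `G`. -/
def extractedFourierMatrix {G : Type*} [AddCommGroup G]
    (A : Finset G) (B : Finset (AddChar G ℂ)) :
    Matrix {χ : AddChar G ℂ // χ ∉ B} {x : G // x ∈ A} ℂ :=
  Matrix.of fun χ x => χ.1 x.1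

/-- The matrix `(a_{ij})_{i ∈ I, j ∈ J}` extracted from `M = (a_{ij})`. -/
def Matrix.extracted {m n R : Type*} (M : Matrix m n R) (I : Finset m) (J : Finset n) :
    Matrix {i : m // i ∈ I} {j : n // j ∈ J} R :=
  M.submatrix Subtype.val Subtype.val

/-- `M` may be decomposed into `N` matrices extracted from `M`, each of rank one: the index set of
`M` is the disjoint union of `N` products `I l × J l`, and each of the corresponding extracted
matrices has rank one. -/
def Matrix.DecomposesIntoRankOne {m n R : Type*} [CommRing R]
    (M : Matrix m n R) (N : ℕ) : Prop :=
  ∃ (I : Fin N → Finset m) (J : Fin N → Finset n),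
    (⋃ l, (I l : Set m) ×ˢ (J l : Set n)) = Set.univ ∧
    (Pairwise fun l l' => Disjoint ((I l : Set m) ×ˢ (J l : Set n)) ((I l' : Set m) ×ˢ (J l' : Set n))) ∧
    ∀ l, (M.extracted (I l) (J l)).rank = 1

set_option linter.unusedSectionVars false

/-! A vector in the kernel of `M`, extended by zero, is a function on `G` supported in `A` with
spectrum inside `B`. Since `|B| = θ(k, G)`, a nonzero one has spectrum exactly `B`. Two independent
ones would have a nonzero combination whose transform vanishes at a chosen point of `B`, so the
kernel is a line and the rank is `k - 1`. The kernel vector `f` is extremal: no nonzero function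
with support of at most the same size has a smaller spectrum. It suffices to cut (complement of the
spectrum) × (support of `f`) into `|supp f| - 1` rank-one blocks; each further column of `A` is one
more block.

To find the extremal functions, write `G` as a union of cosets, with `s` cosets meeting the support
and `t` dual cosets meeting the spectrum. Chebotarev's theorem on each factor gives `|supp f| ≥
s(p+1-t)` and `|spec f| ≥ t(q+1-s)`. Comparison with functions carried by one coset, or constant on
cosets up to a character (`boundary_of_competitors`), forces `s` or `t` to an end of its range. If
`s = 1` or `t = 1`, support and spectrum are explicit and so is the partition.

The other ends must be excluded or reduced to `|supp f| + |spec f| = |G| + 1`, where single rows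
suffice. For `ZMod (p ^ 2)` a sum of `m` monomials with exponents distinct modulo `p` has fewer than
`m` zeros among roots of unity of `p`-power order (`card_roots_lt_card_support`). For `ZMod p × ZMod
p` a change of coordinates puts two points of the support, or two characters of the spectrum, in one
coset. For `p < q` reduction modulo a place above `p` trivializes the characters of `ZMod p` and
keeps those of `ZMod q` independent (`eq_zero_of_injOn_snd`, `two_mul_card_zeros_le`). -/

namespace FourierMatrix

open Finset

/-! ### Reduction modulo a place above `p`, and zeros of sparse polynomials -/

section Reduction

/-- There is a valuation ring of `ℂ` whose residue field has characteristic `p`. -/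
theorem exists_valuationSubring_charP (p : ℕ) [hp : Fact p.Prime] :
    ∃ V : ValuationSubring ℂ, CharP (IsLocalRing.ResidueField V) p := by
  -- The least subring of `ℂ` is `ℤ`, where `p` generates a proper ideal; such an ideal lies in the
  -- nonunits of some valuation ring.
  have hI : Ideal.span {(p : (⊥ : Subring ℂ))} ≠ ⊤ := by
    rw [Ne, Ideal.eq_top_iff_one, Ideal.mem_span_singleton]
    rintro ⟨⟨c, hc⟩, h⟩
    obtain ⟨n, rfl⟩ := Subring.mem_bot.1 hc
    have h2 : (1 : ℂ) = p * n := by simpa using congrArg Subtype.val h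
    have h3 : (1 : ℤ) = p * n := by exact_mod_cast h2
    have h4 := hp.out.one_lt
    have h5 : (p : ℤ) ∣ 1 := ⟨n, h3⟩
    have h6 := Int.le_of_dvd one_pos h5
    omega
  obtain ⟨V, -, hV⟩ := Ideal.image_subset_nonunits_valuationSubring _ hI
  refine ⟨V, ?_⟩
  have h1 : ((p : ℕ) : ℂ) ∈ V.nonunits :=
    hV ⟨p, Ideal.mem_span_singleton_self _, by simp⟩
  have h2 : ((p : ℕ) : IsLocalRing.ResidueField V) = 0 := by
    have h3 : IsLocalRing.residue V (p : V) = 0 := by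
      rw [IsLocalRing.residue_eq_zero_iff, IsLocalRing.mem_maximalIdeal]
      obtain ⟨h, h4⟩ := ValuationSubring.mem_nonunits_iff_exists_mem_maximalIdeal.1 h1
      exact h4
    simpa using h3
  rcases (CharP.exists (IsLocalRing.ResidueField V)) with ⟨r, hr⟩
  have h3 : r ∣ p := (CharP.cast_eq_zero_iff _ r p).1 h2
  rcases (Nat.dvd_prime hp.out).1 h3 with h | h
  · exact absurd h (CharP.char_ne_one (IsLocalRing.ResidueField V) r)
  · exact h ▸ hr

variable {ι : Type*}

/-- A finite nonzero family of complex numbers can be scaled to be integral and nonzero modulo the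
maximal ideal of a given valuation ring. -/
theorem exists_integral_scaling [Finite ι] (V : ValuationSubring ℂ) {f : ι → ℂ} (hf : f ≠ 0) :
    ∃ c : ℂ, c ≠ 0 ∧ ∃ g : ι → V, (∀ i, (g i : ℂ) = c * f i) ∧
      ∃ i, IsLocalRing.residue V (g i) ≠ 0 := by
  obtain ⟨j, hj⟩ := Function.ne_iff.1 hf
  have : Nonempty ι := ⟨j⟩
  -- Division by an entry of greatest valuation makes every entry integral and that entry `1`.
  obtain ⟨i, hi⟩ := Finite.exists_max (fun i => V.valuation (f i))
  have hi0 : f i ≠ 0 := by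
    intro h
    have := hi j
    simp only [h, map_zero, le_zero_iff, map_eq_zero] at this
    exact hj this
  refine ⟨(f i)⁻¹, inv_ne_zero hi0, fun k => ⟨(f i)⁻¹ * f k, ?_⟩, fun k => rfl, i, ?_⟩
  · rw [← V.valuation_le_one_iff, map_mul, map_inv₀]
    rw [inv_mul_le_one₀]
    · exact hi k
    · simpa [zero_lt_iff] using hi0
  · have : (⟨(f i)⁻¹ * f i, by rw [inv_mul_cancel₀ hi0]; exact V.one_mem⟩ : V) = 1 := by
      ext; simp [hi0]
    change IsLocalRing.residue V (⟨(f i)⁻¹ * f i, _⟩ : V) ≠ 0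
    rw [this]; simp

theorem mem_valuationSubring_of_pow_eq_one (V : ValuationSubring ℂ) {z : ℂ} {n : ℕ} (hn : n ≠ 0)
    (hz : z ^ n = 1) : z ∈ V := by
  rw [← V.valuation_le_one_iff]
  have h : V.valuation z ^ n = 1 := by rw [← map_pow, hz, map_one]
  exact (pow_le_one_iff hn).1 h.le

/-- In characteristic `p` the Frobenius gives `(z - 1) ^ p ^ r = z ^ p ^ r - 1 = 0`. -/
theorem residue_eq_one_of_pow_eq_one {V : ValuationSubring ℂ} {p : ℕ} [Fact p.Prime]
    [CharP (IsLocalRing.ResidueField V) p] {z : V} {r : ℕ} (hz : z ^ p ^ r = 1) :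
    IsLocalRing.residue V z = 1 := by
  have h : (IsLocalRing.residue V z) ^ p ^ r = 1 := by rw [← map_pow, hz, map_one]
  have h2 : (IsLocalRing.residue V z - 1) ^ p ^ r = 0 := by
    rw [sub_pow_char_pow, h]; simp
  exact sub_eq_zero.1 (pow_eq_zero_iff (pow_ne_zero _ (Fact.out : p.Prime).ne_zero) |>.1 h2)

/-- Power sums of exponents vanish for a sparse polynomial with a multiple root at `1`. -/
theorem sum_mul_pow_eq_zero_of_X_sub_one_pow_dvd {κ : Type*} [CommRing κ] [Fintype ι] (n : ι → ℕ)
    (i : ℕ) : ∀ (m : ℕ) (b : ι → κ), i < m →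
      (Polynomial.X - 1) ^ m ∣ ∑ j, Polynomial.C (b j) * Polynomial.X ^ n j →
      ∑ j, b j * (n j : κ) ^ i = 0 := by
  induction i with
  | zero =>
    intro m b hm h
    obtain ⟨Q, hQ⟩ := (dvd_pow_self (Polynomial.X - 1 : Polynomial κ) hm.ne').trans h
    have := congrArg (Polynomial.eval 1) hQ
    simpa [Polynomial.eval_finsetSum] using this
  | succ i ih =>
    intro m b hm h
    -- The operator `X · d/dX` multiplies each coefficient by its exponent and lowers the order of
    -- vanishing at `1` by at most one.
    have h2 : (Polynomial.X - 1) ^ (m - 1) ∣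
        ∑ j, Polynomial.C (b j * n j) * Polynomial.X ^ n j := by
      have h3 : ∑ j, Polynomial.C (b j * n j) * Polynomial.X ^ n j =
          Polynomial.X * Polynomial.derivative
            (∑ j, Polynomial.C (b j) * Polynomial.X ^ n j) := by
        rw [Polynomial.derivative_sum, Finset.mul_sum]
        refine Finset.sum_congr rfl fun j _ => ?_
        rw [Polynomial.derivative_C_mul_X_pow]
        rcases Nat.eq_zero_or_pos (n j) with h0 | h0
        · simp [h0]
        · rw [mul_left_comm, ← pow_succ', Nat.sub_add_cancel h0]
      rw [h3]
      refine Dvd.dvd.mul_left ?_ _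
      obtain ⟨Q, hQ⟩ := h
      rw [hQ, Polynomial.derivative_mul]
      refine dvd_add (Dvd.dvd.mul_right ?_ _) (Dvd.dvd.mul_right (pow_dvd_pow _ (Nat.sub_le _ _)) _)
      rw [Polynomial.derivative_pow]
      exact Dvd.dvd.mul_right (Dvd.dvd.mul_left dvd_rfl _) _
    have := ih (m - 1) (fun j => b j * n j) (by omega) h2
    simpa [mul_assoc, pow_succ'] using this

/-- A sparse polynomial over a valuation ring of residue characteristic `p` that vanishes at many
roots of unity of `p`-power order has vanishing power sums of exponents modulo the maximal ideal. -/
theorem sum_residue_mul_pow_eq_zero [Fintype ι] {V : ValuationSubring ℂ} {p : ℕ} [Fact p.Prime]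
    [CharP (IsLocalRing.ResidueField V) p] (a : ι → V) (n : ι → ℕ) (r : ℕ) (Z : Finset ℂ)
    (hZ : ∀ z ∈ Z, z ^ p ^ r = 1) (h0 : ∀ z ∈ Z, ∑ j, (a j : ℂ) * z ^ n j = 0) (i : ℕ)
    (hi : i < #Z) :
    ∑ j, IsLocalRing.residue V (a j) * (n j : IsLocalRing.ResidueField V) ^ i = 0 := by
  have hmem : ∀ z ∈ Z, z ∈ V := fun z hz => mem_valuationSubring_of_pow_eq_one V
    (pow_ne_zero _ (Fact.out : p.Prime).ne_zero) (hZ z hz)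
  set P : Polynomial V := ∑ j, Polynomial.C (a j) * Polynomial.X ^ n j with hP
  have hdvd : ∏ z : Z, (Polynomial.X - Polynomial.C (⟨z.1, hmem z.1 z.2⟩ : V)) ∣ P := by
    by_cases hP0 : P = 0
    · rw [hP0]; exact dvd_zero _
    have := (Multiset.prod_X_sub_C_dvd_iff_le_roots hP0
      ((Finset.univ : Finset Z).val.map (fun z => (⟨z.1, hmem z.1 z.2⟩ : V)))).2 ?_
    · rw [Multiset.map_map] at this
      exact this
    · rw [Multiset.le_iff_subset]
      · intro v hv
        rw [Multiset.mem_map] at hv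
        obtain ⟨z, -, rfl⟩ := hv
        rw [Polynomial.mem_roots hP0, Polynomial.IsRoot, hP, Polynomial.eval_finsetSum]
        ext
        simpa using h0 z.1 z.2
      · refine Multiset.Nodup.map ?_ (Finset.nodup _)
        intro z w h
        exact Subtype.ext (congrArg (Subtype.val : V → ℂ) h)
  have h2 := map_dvd (Polynomial.mapRingHom (IsLocalRing.residue V)) hdvd
  -- All the roots reduce to `1`, so distinct roots merge into one root of multiplicity `#Z`.
  have h3 : Polynomial.mapRingHom (IsLocalRing.residue V)
      (∏ z : Z, (Polynomial.X - Polynomial.C (⟨z.1, hmem z.1 z.2⟩ : V))) =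
      (Polynomial.X - 1) ^ #Z := by
    rw [map_prod]
    have : ∀ z : Z, Polynomial.mapRingHom (IsLocalRing.residue V)
        (Polynomial.X - Polynomial.C (⟨z.1, hmem z.1 z.2⟩ : V)) = Polynomial.X - 1 := by
      intro z
      have : IsLocalRing.residue V (⟨z.1, hmem z.1 z.2⟩ : V) = 1 :=
        residue_eq_one_of_pow_eq_one (p := p) (r := r) (by ext; simpa using hZ z.1 z.2)
      simp [this]
    rw [Finset.prod_congr rfl (fun z _ => this z)]
    simp
  rw [h3] at h2
  refine sum_mul_pow_eq_zero_of_X_sub_one_pow_dvd n i (#Z) _ hi ?_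
  convert h2 using 1
  simp [hP]

/-- Vandermonde: as many moments as there are distinct nodes determine the weights. -/
theorem eq_zero_of_sum_mul_pow_eq_zero {κ : Type*} [Field κ] [Fintype ι] (b v : ι → κ)
    (s : Finset ι) (hv : Set.InjOn v s) (hb : ∀ j, j ∉ s → b j = 0)
    (h : ∀ i < #s, ∑ j, b j * v j ^ i = 0) : b = 0 := by
  have key : (fun i : Fin #s => b (s.equivFin.symm i)) = 0 := by
    refine Matrix.eq_zero_of_forall_pow_sum_mul_pow_eq_zero
      (f := fun i : Fin #s => v (s.equivFin.symm i)) ?_ ?_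
    · intro i j hij
      have := hv (s.equivFin.symm i).2 (s.equivFin.symm j).2 hij
      exact s.equivFin.symm.injective (Subtype.ext this)
    · intro i
      rw [← h i i.2, ← Finset.sum_subset (Finset.subset_univ s)]
      · rw [← Finset.sum_coe_sort s]
        exact Equiv.sum_comp s.equivFin.symm (fun j : s => b j * v j ^ (i : ℕ))
      · intro j _ hj
        rw [hb j hj, zero_mul]
  funext j
  by_cases hj : j ∈ s
  · have := congrFun key (s.equivFin ⟨j, hj⟩)
    simpa using this
  · exact hb j hj

/-- A sum of `m` monomials whose exponents are distinct modulo `p` vanishes at fewer than `m` roots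
of unity of `p`-power order. -/
theorem card_roots_lt_card_support [Fintype ι] {p : ℕ} [hp : Fact p.Prime] (f : ι → ℂ) (hf : f ≠ 0)
    (n : ι → ℕ) (s : Finset ι) (hs : ∀ j, j ∉ s → f j = 0)
    (hn : Set.InjOn (fun j => (n j : ZMod p)) s) (r : ℕ) (Z : Finset ℂ)
    (hZ : ∀ z ∈ Z, z ^ p ^ r = 1) (h0 : ∀ z ∈ Z, ∑ j, f j * z ^ n j = 0) :
    #Z < #s := by
  by_contra! hlt
  obtain ⟨V, hV⟩ := exists_valuationSubring_charP p
  obtain ⟨c, hc, g, hg, i, hi⟩ := exists_integral_scaling V hf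
  apply hi
  refine congrFun (eq_zero_of_sum_mul_pow_eq_zero
    (fun j => IsLocalRing.residue V (g j)) (fun j => (n j : IsLocalRing.ResidueField V)) s ?_ ?_ ?_) i
  · intro j hj k hk hjk
    refine hn hj hk ?_
    simp only at hjk ⊢
    rw [CharP.natCast_eq_natCast (IsLocalRing.ResidueField V) p] at hjk
    rwa [ZMod.natCast_eq_natCast_iff]
  · intro j hj
    have : g j = 0 := by ext; simp [hg, hs j hj]
    simp [this]
  · intro i hi
    refine sum_residue_mul_pow_eq_zero (p := p) g n r Z hZ ?_ i (hi.trans_le hlt)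
    intro z hz
    simp only [hg, mul_assoc, ← Finset.mul_sum, h0 z hz, mul_zero]

end Reduction

/-! ### Partitions into rank-one blocks -/

section RankOnePartition

variable {m n m' n' : Type*}

/-- The block `R × C` of the kernel `K` can be cut successively, along rows or columns, into `N`
nonempty blocks on which `K` has the form `a i * b j`. -/
inductive RankOnePartition [DecidableEq m] [DecidableEq n] (K : m → n → ℂ) :
    Finset m → Finset n → ℕ → Prop
  | empty_rows (C : Finset n) : RankOnePartition K ∅ C 0
  | empty_cols (R : Finset m) : RankOnePartition K R ∅ 0
  | block {R : Finset m} {C : Finset n} (hR : R.Nonempty) (hC : C.Nonempty) (a : m → ℂ)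
      (b : n → ℂ) (h : ∀ i ∈ R, ∀ j ∈ C, K i j = a i * b j) : RankOnePartition K R C 1
  | union_rows {R₁ R₂ : Finset m} {C : Finset n} {N₁ N₂ : ℕ} (h : Disjoint R₁ R₂)
      (h₁ : RankOnePartition K R₁ C N₁) (h₂ : RankOnePartition K R₂ C N₂) :
      RankOnePartition K (R₁ ∪ R₂) C (N₁ + N₂)
  | union_cols {R : Finset m} {C₁ C₂ : Finset n} {N₁ N₂ : ℕ} (h : Disjoint C₁ C₂)
      (h₁ : RankOnePartition K R C₁ N₁) (h₂ : RankOnePartition K R C₂ N₂) :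
      RankOnePartition K R (C₁ ∪ C₂) (N₁ + N₂)

variable [DecidableEq m] [DecidableEq n] [DecidableEq m'] [DecidableEq n'] {K : m → n → ℂ}

namespace RankOnePartition

theorem biUnion_rows {ι : Type*} [DecidableEq ι] {C : Finset n} (s : Finset ι)
    (R : ι → Finset m) (N : ℕ)
    (hd : (s : Set ι).PairwiseDisjoint R) (h : ∀ i ∈ s, RankOnePartition K (R i) C N) :
    RankOnePartition K (s.biUnion R) C (#s * N) := by
  induction s using Finset.induction_on with
  | empty => simpa using empty_rows C
  | insert i s hi ih =>
    rw [Finset.biUnion_insert, Finset.card_insert_of_notMem hi, add_mul, one_mul, add_comm]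
    refine union_rows ?_ (h i (mem_insert_self _ _)) (ih ?_ fun j hj => h j (mem_insert_of_mem hj))
    · rw [Finset.disjoint_biUnion_right]
      intro j hj
      refine hd (by simp) (by simp [hj]) ?_
      rintro rfl; exact hi hj
    · exact hd.subset (by simp)

theorem biUnion_cols {ι : Type*} [DecidableEq ι] {R : Finset m} (s : Finset ι)
    (C : ι → Finset n) (N : ℕ)
    (hd : (s : Set ι).PairwiseDisjoint C) (h : ∀ i ∈ s, RankOnePartition K R (C i) N) :
    RankOnePartition K R (s.biUnion C) (#s * N) := by
  induction s using Finset.induction_on with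
  | empty => simpa using empty_cols R
  | insert i s hi ih =>
    rw [Finset.biUnion_insert, Finset.card_insert_of_notMem hi, add_mul, one_mul, add_comm]
    refine union_cols ?_ (h i (mem_insert_self _ _)) (ih ?_ fun j hj => h j (mem_insert_of_mem hj))
    · rw [Finset.disjoint_biUnion_right]
      intro j hj
      refine hd (by simp) (by simp [hj]) ?_
      rintro rfl; exact hi hj
    · exact hd.subset (by simp)

theorem single_rows (R : Finset m) {C : Finset n} (hC : C.Nonempty) :
    RankOnePartition K R C #R := by
  have h := biUnion_rows (K := K) (C := C) R (fun i => {i}) 1 ?_ ?_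
  · simpa using h
  · intro i _ j _ hij
    simpa using hij
  · intro i _
    exact block (singleton_nonempty i) hC 1 (K i) (by simp)

theorem single_cols {R : Finset m} (hR : R.Nonempty) (C : Finset n) :
    RankOnePartition K R C #C := by
  have h := biUnion_cols (K := K) (R := R) C (fun i => {i}) 1 ?_ ?_
  · simpa using h
  · intro i _ j _ hij
    simpa using hij
  · intro j _
    exact block hR (singleton_nonempty j) (fun i => K i j) 1 (by simp)

/-- Each added column is a single block. This needs at least one row, because blocks are nonempty.
-/
theorem extend_cols {R : Finset m} {C₀ C : Finset n} {N : ℕ} (h : RankOnePartition K R C₀ N)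
    (hC : C₀ ⊆ C) (hR : C₀ ≠ C → R.Nonempty) : RankOnePartition K R C (N + (#C - #C₀)) := by
  by_cases h0 : C₀ = C
  · subst h0; simpa using h
  · have := union_cols disjoint_sdiff h (single_cols (K := K) (hR h0) (C \ C₀))
    rwa [union_sdiff_of_subset hC, card_sdiff_of_subset hC] at this

theorem map_equiv (D : m' ≃ m) (E : n' ≃ n) {R : Finset m'} {C : Finset n'} {N : ℕ}
    (h : RankOnePartition (fun i j => K (D i) (E j)) R C N) :
    RankOnePartition K (R.map D.toEmbedding) (C.map E.toEmbedding) N := by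
  induction h with
  | empty_rows C => simpa using empty_rows _
  | empty_cols R => simpa using empty_cols _
  | block hR hC a b h =>
    refine block (by simpa using hR) (by simpa using hC) (a ∘ D.symm) (b ∘ E.symm) ?_
    intro i hi j hj
    simpa using h (D.symm i) (by simpa using hi) (E.symm j) (by simpa using hj)
  | union_rows hd _ _ h₁ h₂ =>
    rw [Finset.map_union]
    exact union_rows (by simpa using hd) h₁ h₂
  | union_cols hd _ _ h₁ h₂ =>
    rw [Finset.map_union]
    exact union_cols (by simpa using hd) h₁ h₂

/-- Flattens the successive cuts into one family. Nonemptiness is recorded because, for a kernel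
without zeros, it makes the rank of each block exactly one. -/
theorem exists_blocks {R : Finset m} {C : Finset n} {N : ℕ} (h : RankOnePartition K R C N) :
    ∃ (Λ : Type) (_ : Fintype Λ) (I : Λ → Finset m) (J : Λ → Finset n), Fintype.card Λ = N ∧
      (∀ l, (I l).Nonempty ∧ (J l).Nonempty ∧ I l ⊆ R ∧ J l ⊆ C ∧
        ∃ (a : m → ℂ) (b : n → ℂ), ∀ i ∈ I l, ∀ j ∈ J l, K i j = a i * b j) ∧
      ∀ i ∈ R, ∀ j ∈ C, ∃! l, i ∈ I l ∧ j ∈ J l := by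
  induction h with
  | empty_rows C => exact ⟨Empty, inferInstance, nofun, nofun, by simp, by simp, by simp⟩
  | empty_cols R => exact ⟨Empty, inferInstance, nofun, nofun, by simp, by simp, by simp⟩
  | @block R C hR hC a b h =>
    refine ⟨Unit, inferInstance, fun _ => R, fun _ => C, by simp,
      fun _ => ⟨hR, hC, subset_rfl, subset_rfl, a, b, h⟩, fun i hi j hj => ⟨(), ⟨hi, hj⟩, by simp⟩⟩
  | @union_rows R₁ R₂ C N₁ N₂ hd _ _ h₁ h₂ =>
    obtain ⟨Λ₁, _, I₁, J₁, hc₁, hb₁, hu₁⟩ := h₁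
    obtain ⟨Λ₂, _, I₂, J₂, hc₂, hb₂, hu₂⟩ := h₂
    refine ⟨Λ₁ ⊕ Λ₂, inferInstance, Sum.elim I₁ I₂, Sum.elim J₁ J₂, by simp [hc₁, hc₂], ?_, ?_⟩
    · rintro (l | l)
      · obtain ⟨h1, h2, h3, h4, h5⟩ := hb₁ l
        exact ⟨h1, h2, h3.trans subset_union_left, h4, h5⟩
      · obtain ⟨h1, h2, h3, h4, h5⟩ := hb₂ l
        exact ⟨h1, h2, h3.trans subset_union_right, h4, h5⟩
    · intro i hi j hj
      rcases mem_union.1 hi with hi | hi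
      · obtain ⟨l, hl, hl2⟩ := hu₁ i hi j hj
        refine ⟨Sum.inl l, hl, ?_⟩
        rintro (l' | l') hl'
        · exact congrArg Sum.inl (hl2 l' hl')
        · exact absurd ((hb₂ l').2.2.1 hl'.1) (disjoint_left.1 hd hi)
      · obtain ⟨l, hl, hl2⟩ := hu₂ i hi j hj
        refine ⟨Sum.inr l, hl, ?_⟩
        rintro (l' | l') hl'
        · exact absurd hi (disjoint_left.1 hd ((hb₁ l').2.2.1 hl'.1))
        · exact congrArg Sum.inr (hl2 l' hl')
  | @union_cols R C₁ C₂ N₁ N₂ hd _ _ h₁ h₂ =>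
    obtain ⟨Λ₁, _, I₁, J₁, hc₁, hb₁, hu₁⟩ := h₁
    obtain ⟨Λ₂, _, I₂, J₂, hc₂, hb₂, hu₂⟩ := h₂
    refine ⟨Λ₁ ⊕ Λ₂, inferInstance, Sum.elim I₁ I₂, Sum.elim J₁ J₂, by simp [hc₁, hc₂], ?_, ?_⟩
    · rintro (l | l)
      · obtain ⟨h1, h2, h3, h4, h5⟩ := hb₁ l
        exact ⟨h1, h2, h3, h4.trans subset_union_left, h5⟩
      · obtain ⟨h1, h2, h3, h4, h5⟩ := hb₂ l
        exact ⟨h1, h2, h3, h4.trans subset_union_right, h5⟩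
    · intro i hi j hj
      rcases mem_union.1 hj with hj | hj
      · obtain ⟨l, hl, hl2⟩ := hu₁ i hi j hj
        refine ⟨Sum.inl l, hl, ?_⟩
        rintro (l' | l') hl'
        · exact congrArg Sum.inl (hl2 l' hl')
        · exact absurd ((hb₂ l').2.2.2.1 hl'.2) (disjoint_left.1 hd hj)
      · obtain ⟨l, hl, hl2⟩ := hu₂ i hi j hj
        refine ⟨Sum.inr l, hl, ?_⟩
        rintro (l' | l') hl'
        · exact absurd hj (disjoint_left.1 hd ((hb₁ l').2.2.2.1 hl'.2))
        · exact congrArg Sum.inr (hl2 l' hl')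

/-- The subtype matrix of a block with a rank-one partition decomposes into rank-one matrices. -/
theorem decomposesIntoRankOne {R : Finset m} {C : Finset n} {N : ℕ}
    (h : RankOnePartition K R C N) (hK : ∀ i j, K i j ≠ 0) {p : m → Prop} {q : n → Prop}
    (hp : ∀ i, p i ↔ i ∈ R) (hq : ∀ j, q j ↔ j ∈ C) :
    (Matrix.of fun (i : {i // p i}) (j : {j // q j}) => K i.1 j.1).DecomposesIntoRankOne N := by
  classical
  obtain ⟨Λ, _, I, J, hc, hb, hu⟩ := h.exists_blocks
  let e : Fin N ≃ Λ := (Fintype.equivFinOfCardEq hc).symm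
  refine ⟨fun l => (I (e l)).subtype p, fun l => (J (e l)).subtype q, ?_, ?_, ?_⟩
  · rw [Set.eq_univ_iff_forall]
    rintro ⟨i, j⟩
    obtain ⟨l, hl, -⟩ := hu i.1 ((hp _).1 i.2) j.1 ((hq _).1 j.2)
    rw [Set.mem_iUnion]
    exact ⟨e.symm l, by simpa using hl⟩
  · intro l l' hll
    rw [Set.disjoint_left]
    rintro ⟨i, j⟩ h1 h2
    apply hll
    obtain ⟨l₀, -, hl⟩ := hu i.1 ((hp _).1 i.2) j.1 ((hq _).1 j.2)
    apply e.injective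
    rw [hl (e l) (by simpa using h1), hl (e l') (by simpa using h2)]
  · intro l
    obtain ⟨⟨i₀, hi₀⟩, ⟨j₀, hj₀⟩, hI, hJ, a, b, hab⟩ := hb (e l)
    refine le_antisymm ?_ ?_
    · have hM : (Matrix.of fun (i : {i // p i}) (j : {j // q j}) => K i.1 j.1).extracted
          ((I (e l)).subtype p) ((J (e l)).subtype q) =
          Matrix.vecMulVec (fun i => a i.1.1) (fun j => b j.1.1) := by
        ext i j
        exact hab _ (mem_subtype.1 i.2) _ (mem_subtype.1 j.2)
      rw [hM]
      exact Matrix.rank_vecMulVec_le _ _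
    · rw [Nat.one_le_iff_ne_zero]
      intro h0
      have h1 : Matrix.mulVecLin ((Matrix.of fun (i : {i // p i}) (j : {j // q j}) =>
          K i.1 j.1).extracted ((I (e l)).subtype p) ((J (e l)).subtype q)) = 0 := by
        rw [Matrix.rank, Submodule.finrank_eq_zero, LinearMap.range_eq_bot] at h0
        exact h0
      have h2 := congrFun (LinearMap.congr_fun h1
        (Pi.single ⟨⟨j₀, (hq _).2 (hJ hj₀)⟩, by simpa using hj₀⟩ 1))
        ⟨⟨i₀, (hp _).2 (hI hi₀)⟩, by simpa using hi₀⟩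
      rw [Matrix.mulVecLin_apply, Matrix.mulVec_single_one] at h2
      exact hK _ _ h2

end RankOnePartition

end RankOnePartition

/-! ### Support, spectrum and extremal functions -/

section Extremal

variable {m n m' n' : Type*}

/-- The points where `f` does not vanish. -/
noncomputable def supp [Fintype n] (f : n → ℂ) : Finset n :=
  {j | f j ≠ 0}

/-- The indices where the transform of `f` with kernel `K` does not vanish. -/
noncomputable def spec [Fintype m] [Fintype n] (K : m → n → ℂ) (f : n → ℂ) : Finset m :=
  {i | ∑ j, K i j * f j ≠ 0}

/-- `f` has the least spectrum among the nonzero functions with support of at most the same size. -/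
def IsExtremal [Fintype m] [Fintype n] (K : m → n → ℂ) (f : n → ℂ) : Prop :=
  f ≠ 0 ∧ ∀ g : n → ℂ, g ≠ 0 → #(supp g) ≤ #(supp f) → #(spec K f) ≤ #(spec K g)

variable [Fintype m] [Fintype n] [Fintype m'] [Fintype n']

@[simp] theorem mem_supp {f : n → ℂ} {j : n} : j ∈ supp f ↔ f j ≠ 0 := by simp [supp]

@[simp] theorem mem_spec {K : m → n → ℂ} {f : n → ℂ} {i : m} :
    i ∈ spec K f ↔ ∑ j, K i j * f j ≠ 0 := by simp [spec]

theorem supp_nonempty {f : n → ℂ} (hf : f ≠ 0) : (supp f).Nonempty := by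
  obtain ⟨j, hj⟩ := Function.ne_iff.1 hf
  exact ⟨j, by simpa using hj⟩

theorem supp_comp_equiv (E : n' ≃ n) (f : n → ℂ) : (supp (f ∘ E)).map E.toEmbedding = supp f := by
  ext j; simp

theorem spec_comp_equiv (D : m' ≃ m) (E : n' ≃ n) (K : m → n → ℂ) (f : n → ℂ) :
    (spec (fun i j => K (D i) (E j)) (f ∘ E)).map D.toEmbedding = spec K f := by
  ext i
  simp [Equiv.sum_comp E (fun j => K i j * f j)]

theorem card_supp_comp_equiv (E : n' ≃ n) (f : n → ℂ) : #(supp (f ∘ E)) = #(supp f) := by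
  rw [← supp_comp_equiv E f, card_map]

theorem card_spec_comp_equiv (D : m' ≃ m) (E : n' ≃ n) (K : m → n → ℂ) (f : n → ℂ) :
    #(spec (fun i j => K (D i) (E j)) (f ∘ E)) = #(spec K f) := by
  rw [← spec_comp_equiv D E K f, card_map]

theorem IsExtremal.comp_equiv (D : m' ≃ m) (E : n' ≃ n) {K : m → n → ℂ} {f : n → ℂ}
    (h : IsExtremal K f) : IsExtremal (fun i j => K (D i) (E j)) (f ∘ E) := by
  refine ⟨fun h0 => h.1 ?_, fun g hg hle => ?_⟩
  · funext j
    simpa using congrFun h0 (E.symm j)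
  · have hgE : (g ∘ E.symm) ∘ E = g := by ext; simp
    rw [card_spec_comp_equiv D E K f]
    rw [← hgE, card_spec_comp_equiv D E K]
    refine h.2 _ (fun h0 => hg ?_) ?_
    · rw [← hgE, h0]; rfl
    · rw [← card_supp_comp_equiv E, hgE]
      exact hle.trans (card_supp_comp_equiv E f).le

/-- The conclusion about an extremal function: off its spectrum, the kernel restricted to the
support is cut into one rank-one block fewer than there are columns. -/
def HasRankOnePartition [DecidableEq m] [DecidableEq n] (K : m → n → ℂ) (f : n → ℂ) : Prop :=
  RankOnePartition K (spec K f)ᶜ (supp f) (#(supp f) - 1)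

theorem HasRankOnePartition.of_comp_equiv [DecidableEq m] [DecidableEq n] [DecidableEq m']
    [DecidableEq n'] (D : m' ≃ m) (E : n' ≃ n) {K : m → n → ℂ} {f : n → ℂ}
    (h : HasRankOnePartition (fun i j => K (D i) (E j)) (f ∘ E)) : HasRankOnePartition K f := by
  have := RankOnePartition.map_equiv (K := K) D E h
  have h2 : ((spec (fun i j => K (D i) (E j)) (f ∘ E))ᶜ).map D.toEmbedding = (spec K f)ᶜ := by
    ext i
    simp [Equiv.sum_comp E (fun j => K i j * f j)]
  rwa [supp_comp_equiv, h2, card_supp_comp_equiv] at this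

/-- Exactly `#(supp f) - 1` rows lie off the spectrum, and each row is a block. -/
theorem hasRankOnePartition_of_card_add_card [DecidableEq m] [DecidableEq n] {K : m → n → ℂ}
    {f : n → ℂ} (hf : f ≠ 0) (h : #(supp f) + #(spec K f) = Fintype.card m + 1) :
    HasRankOnePartition K f := by
  have := RankOnePartition.single_rows (K := K) (spec K f)ᶜ (supp_nonempty hf)
  rw [card_compl] at this
  unfold HasRankOnePartition
  have h2 := card_le_univ (spec K f)
  convert this using 1
  omega

/-- A nonzero vector with prescribed support that is annihilated by few rows. -/
theorem exists_ne_zero_of_card_lt {K : m → n → ℂ} (C : Finset n) (R : Finset m) (h : #R < #C) :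
    ∃ g : n → ℂ, g ≠ 0 ∧ (∀ j, j ∉ C → g j = 0) ∧ ∀ i ∈ R, ∑ j, K i j * g j = 0 := by
  classical
  let M : Matrix R C ℂ := Matrix.of fun i j => K i.1 j.1
  have hker : M.mulVecLin.ker ≠ ⊥ := by
    apply LinearMap.ker_ne_bot_of_finrank_lt
    simpa using h
  obtain ⟨v, hv, hv0⟩ := Submodule.exists_mem_ne_zero_of_ne_bot hker
  refine ⟨fun j => if hj : j ∈ C then v ⟨j, hj⟩ else 0, ?_, ?_, ?_⟩
  · intro h0
    apply hv0
    funext j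
    simpa using congrFun h0 j.1
  · intro j hj
    simp [hj]
  · intro i hi
    have := congrFun (LinearMap.mem_ker.1 hv) ⟨i, hi⟩
    simp only [Matrix.mulVecLin_apply, Matrix.mulVec, dotProduct, Pi.zero_apply] at this
    rw [← Finset.sum_subset (Finset.subset_univ C) (by intro j _ hj; simp [hj]),
      ← Finset.sum_coe_sort C, ← this]
    refine Finset.sum_congr rfl fun j _ => ?_
    simp [M]

end Extremal

/-! ### From the minimality of `θ(k, G)` to extremal functions -/

section Meshulam

variable {G : Type*} [AddCommGroup G] [Fintype G]

/-- The pairing of characters and elements. -/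
def pairing (G : Type*) [AddCommGroup G] (χ : AddChar G ℂ) (x : G) : ℂ := χ x

theorem addChar_ne_zero (χ : AddChar G ℂ) (x : G) : χ x ≠ 0 := by
  intro h
  have := χ.map_add_eq_mul x (-x)
  simp [h] at this

theorem eq_zero_of_spec_eq_empty {g : G → ℂ} (h : spec (pairing G) g = ∅) : g = 0 := by
  classical
  funext y
  have h1 : ∀ χ : AddChar G ℂ, ∑ x, χ x * g x = 0 := by
    intro χ
    by_contra h2
    have : χ ∈ spec (pairing G) g := by simpa [pairing] using h2
    simp [h] at this
  have h2 : ∑ χ : AddChar G ℂ, χ (-y) * ∑ x, χ x * g x = (Fintype.card G : ℂ) * g y := by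
    simp_rw [Finset.mul_sum, ← mul_assoc, ← AddChar.map_add_eq_mul]
    rw [Finset.sum_comm]
    simp_rw [← Finset.sum_mul, AddChar.sum_apply_eq_ite, neg_add_eq_zero]
    simp
  simp only [h1, mul_zero, sum_const_zero] at h2
  have h3 : (Fintype.card G : ℂ) ≠ 0 := by simp
  simpa using (mul_eq_zero.1 h2.symm).resolve_left h3

/-- The reflection `x ↦ g (-x)` converts the kernel `χ (-x)` of `fourierTransform` into the kernel
`χ x` of `pairing`. -/
theorem meshulamTheta_le {k : ℕ} {g : G → ℂ} (hg : g ≠ 0) (hk : #(supp g) ≤ k) :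
    meshulamTheta k G ≤ #(spec (pairing G) g) := by
  have h1 : fourierTransform (fun x => g (-x)) = fun χ => ∑ x, χ x * g x := by
    funext χ
    rw [fourierTransform, ← Equiv.sum_comp (Equiv.neg G)]
    simp [mul_comm]
  refine Nat.sInf_le ⟨?_, fun x => g (-x), ⟨?_, ?_⟩, ?_⟩
  · rw [card_pos]
    by_contra h
    exact hg (eq_zero_of_spec_eq_empty (not_nonempty_iff_eq_empty.1 h))
  · refine le_trans (le_of_eq ?_) hk
    rw [← card_supp_comp_equiv (Equiv.neg G) g, ← Set.ncard_coe_finset]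
    congr 1
    ext x; simp
  · rw [h1, ← Set.ncard_coe_finset]
    congr 1
    ext χ; simp [pairing]
  · intro h
    apply hg
    funext x
    simpa using congrFun h (-x)

/-- The theorem follows from the rank-one partition for extremal functions. -/
theorem rank_and_decomposition_of_hasRankOnePartition [DecidableEq G] [DecidableEq (AddChar G ℂ)]
    (hG : ∀ f : G → ℂ, IsExtremal (pairing G) f → HasRankOnePartition (pairing G) f)
    (k : ℕ) (A : Finset G) (B : Finset (AddChar G ℂ))
    (hA : #A = k) (hB : #B = meshulamTheta k G)
    (hrank : (extractedFourierMatrix A B).rank ≠ k) :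
    (extractedFourierMatrix A B).rank = k - 1 ∧
      (extractedFourierMatrix A B).DecomposesIntoRankOne (k - 1) := by
  set M := extractedFourierMatrix A B with hM
  let ext : ({x // x ∈ A} → ℂ) → G → ℂ := fun v x => if hx : x ∈ A then v ⟨x, hx⟩ else 0
  have hext_supp : ∀ v, supp (ext v) ⊆ A := by
    intro v x hx
    by_contra hxA
    simp [ext, hxA] at hx
  have hext_zero : ∀ v, ext v = 0 → v = 0 := by
    intro v hv
    funext x
    simpa [ext] using congrFun hv x.1
  have hext_sum : ∀ v (χ : AddChar G ℂ),
      ∑ x, χ x * ext v x = ∑ x : {x // x ∈ A}, χ x * v x := by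
    intro v χ
    rw [← Finset.sum_subset (Finset.subset_univ A) (by intro j _ hj; simp [ext, hj]),
      ← Finset.sum_coe_sort A]
    exact Finset.sum_congr rfl fun x _ => by simp [ext]
  have hker_spec : ∀ v ∈ M.mulVecLin.ker, spec (pairing G) (ext v) ⊆ B := by
    intro v hv χ hχ
    by_contra hB
    rw [mem_spec] at hχ
    apply hχ
    simp only [pairing]
    rw [hext_sum]
    exact congrFun (LinearMap.mem_ker.1 hv) ⟨χ, hB⟩
  have hspec : ∀ v ∈ M.mulVecLin.ker, v ≠ 0 → spec (pairing G) (ext v) = B := by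
    intro v hv hv0
    refine eq_of_subset_of_card_le (hker_spec v hv) ?_
    rw [hB]
    exact meshulamTheta_le (fun h => hv0 (hext_zero v h)) ((card_le_card (hext_supp v)).trans hA.le)
  have hrk : M.rank + Module.finrank ℂ M.mulVecLin.ker = k := by
    have := M.mulVecLin.finrank_range_add_finrank_ker
    rw [Matrix.rank, this]
    simp [hA]
  have hker : M.mulVecLin.ker ≠ ⊥ := by
    intro h
    rw [h, finrank_bot] at hrk
    exact hrank (by simpa using hrk)
  obtain ⟨v, hv, hv0⟩ := Submodule.exists_mem_ne_zero_of_ne_bot hker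
  have hf0 : ext v ≠ 0 := fun h => hv0 (hext_zero v h)
  have hBne : B.Nonempty := by
    rw [← hspec v hv hv0]
    by_contra h
    exact hf0 (eq_zero_of_spec_eq_empty (not_nonempty_iff_eq_empty.1 h))
  obtain ⟨χ, hχ⟩ := hBne
  have hdim : Module.finrank ℂ M.mulVecLin.ker = 1 := by
    rw [finrank_eq_one_iff']
    refine ⟨⟨v, hv⟩, fun h => hv0 (congrArg Subtype.val h), ?_⟩
    rintro ⟨w, hw⟩
    have hχv : ∑ x : {x // x ∈ A}, χ x * v x ≠ 0 := by
      rw [← hext_sum]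
      rw [← hspec v hv hv0] at hχ
      simpa [pairing] using hχ
    -- The constant makes the transform of `w - c • v` vanish at `χ ∈ B`. As a nonzero kernel vector
    -- has spectrum all of `B`, this difference is zero.
    set c := (∑ x : {x // x ∈ A}, χ x * w x) / ∑ x : {x // x ∈ A}, χ x * v x with hc
    refine ⟨c, ?_⟩
    have hmem : w - c • v ∈ M.mulVecLin.ker := Submodule.sub_mem _ hw (Submodule.smul_mem _ _ hv)
    by_contra hne
    have hne2 : w - c • v ≠ 0 := by
      intro h
      apply hne
      ext1
      exact (sub_eq_zero.1 h).symm
    have h1 := hspec _ hmem hne2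
    rw [← h1, mem_spec] at hχ
    apply hχ
    simp only [pairing]
    rw [hext_sum]
    have : ∀ x : {x // x ∈ A}, χ x * (w - c • v) x = χ x * w x - c * (χ x * v x) := by
      intro x; simp; ring
    simp only [this, sum_sub_distrib, ← mul_sum]
    rw [hc, div_mul_cancel₀ _ hχv, sub_self]
  have hrk1 : M.rank = k - 1 := by omega
  refine ⟨hrk1, ?_⟩
  have hext : IsExtremal (pairing G) (ext v) := by
    refine ⟨hf0, fun g hg hle => ?_⟩
    rw [hspec v hv hv0, hB]
    exact meshulamTheta_le hg (hle.trans ((card_le_card (hext_supp v)).trans hA.le))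
  have hpart := hG _ hext
  rw [HasRankOnePartition, hspec v hv hv0] at hpart
  have hsp := card_pos.2 (supp_nonempty hf0)
  have hsA := card_le_card (hext_supp v)
  have hpart2 := hpart.extend_cols (hext_supp v) ?_
  · have : #(supp (ext v)) - 1 + (#A - #(supp (ext v))) = k - 1 := by omega
    rw [this] at hpart2
    exact hpart2.decomposesIntoRankOne (fun χ x => addChar_ne_zero χ x) (by simp) (by simp)
  -- If no row is left, then `M` has rank `0 = k - 1`, so `A` is a single point and equals the
  -- support.
  · intro hne
    by_contra hemp
    have h1 : M.rank ≤ 0 := by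
      have := M.rank_le_card_height
      have h2 : Fintype.card {χ : AddChar G ℂ // χ ∉ B} = 0 := by
        rw [Fintype.card_eq_zero_iff, isEmpty_subtype]
        intro χ hχ
        exact hemp ⟨χ, by simpa using hχ⟩
      omega
    exact hne (eq_of_subset_of_card_le (hext_supp v) (by omega))

end Meshulam

/-! ### Fourier matrices of extensions: slices, competitors and the extreme cases -/

section SplitKernel

variable {X Y Ξ N : Type*} [Fintype X] [Fintype Y] [Fintype Ξ] [Fintype N]
  [DecidableEq X] [DecidableEq Y] [DecidableEq Ξ] [DecidableEq N]

/-- The uncertainty inequality that Chebotarev's theorem gives for the Fourier matrix of a group of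
prime order. -/
def IsChebotarev (P : Ξ → X → ℂ) : Prop :=
  ∀ g : X → ℂ, g ≠ 0 → Fintype.card X + 1 ≤ #(supp g) + #(spec P g)

/-- The kernel of the Fourier transform of an extension of a group with kernel `Q` by a group with
kernel `P`, in coordinates; `u` is the twist. -/
def splitKernel (P : Ξ → X → ℂ) (u : Ξ → Y → ℂ) (Q : N → Y → ℂ) : Ξ × N → X × Y → ℂ :=
  fun ζ z => P ζ.1 z.1 * u ζ.1 z.2 * Q ζ.2 z.2

variable {P : Ξ → X → ℂ} {u : Ξ → Y → ℂ} {Q : N → Y → ℂ} {f : X × Y → ℂ}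

theorem sum_splitKernel (ζ : Ξ × N) (f : X × Y → ℂ) :
    ∑ z, splitKernel P u Q ζ z * f z =
      ∑ y, Q ζ.2 y * (u ζ.1 y * ∑ x, P ζ.1 x * f (x, y)) := by
  rw [Fintype.sum_prod_type_right]
  refine Finset.sum_congr rfl fun y _ => ?_
  simp only [Finset.mul_sum, splitKernel]
  exact Finset.sum_congr rfl fun x _ => by ring

theorem card_filter_snd_eq (f : X × Y → ℂ) (y : Y) :
    #{z ∈ supp f | z.2 = y} = #(supp fun x => f (x, y)) := by
  refine (Finset.card_bij (fun x _ => (x, y)) ?_ ?_ ?_).symm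
  · intro x hx; simpa using hx
  · intro x _ x' _ h; simpa using h
  · rintro ⟨x, y'⟩ h
    simp only [mem_filter, mem_supp] at h
    obtain ⟨h1, rfl⟩ := h
    exact ⟨x, by simpa using h1, rfl⟩

theorem card_filter_fst_eq (ξ : Ξ) :
    #{ζ ∈ spec (splitKernel P u Q) f | ζ.1 = ξ} =
      #(spec Q fun y => u ξ y * ∑ x, P ξ x * f (x, y)) := by
  refine (Finset.card_bij (fun η _ => (ξ, η)) ?_ ?_ ?_).symm
  · intro η h
    simpa [sum_splitKernel] using h
  · intro x _ x' _ h; simpa using h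
  · rintro ⟨ξ', η⟩ h
    simp only [mem_filter, mem_spec, sum_splitKernel] at h
    obtain ⟨h1, rfl⟩ := h
    exact ⟨η, by simpa using h1, rfl⟩

/-- The cosets that meet the support. -/
noncomputable def suppImage (f : X × Y → ℂ) : Finset Y := (supp f).image Prod.snd

/-- The cosets that meet the spectrum. -/
noncomputable def specImage (P : Ξ → X → ℂ) (u : Ξ → Y → ℂ) (Q : N → Y → ℂ) (f : X × Y → ℂ) :
    Finset Ξ := (spec (splitKernel P u Q) f).image Prod.fst

theorem mem_suppImage {y : Y} : y ∈ suppImage f ↔ ∃ x, f (x, y) ≠ 0 := by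
  simp [suppImage]

theorem mem_specImage {ξ : Ξ} :
    ξ ∈ specImage P u Q f ↔ ∃ η, (ξ, η) ∈ spec (splitKernel P u Q) f := by
  simp [specImage]

theorem card_supp_eq_sum (f : X × Y → ℂ) :
    #(supp f) = ∑ y ∈ suppImage f, #{z ∈ supp f | z.2 = y} :=
  card_eq_sum_card_image _ _

theorem card_spec_eq_sum (f : X × Y → ℂ) :
    #(spec (splitKernel P u Q) f) =
      ∑ ξ ∈ specImage P u Q f, #{ζ ∈ spec (splitKernel P u Q) f | ζ.1 = ξ} :=
  card_eq_sum_card_image _ _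

theorem IsChebotarev.spec_nonempty (hQ : IsChebotarev Q) {g : Y → ℂ} (hg : g ≠ 0) :
    (spec Q g).Nonempty := by
  have h1 := hQ g hg
  have h2 := card_le_univ (supp g)
  rw [← card_pos]
  omega

theorem mem_specImage_of_ne_zero (hQ : IsChebotarev Q) (hu : ∀ ξ y, u ξ y ≠ 0) {ξ : Ξ} {y : Y}
    (h : ∑ x, P ξ x * f (x, y) ≠ 0) : ξ ∈ specImage P u Q f := by
  have h1 : (fun y => u ξ y * ∑ x, P ξ x * f (x, y)) ≠ 0 := by
    intro h0
    exact mul_ne_zero (hu ξ y) h (congrFun h0 y)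
  obtain ⟨η, hη⟩ := hQ.spec_nonempty h1
  rw [mem_specImage]
  refine ⟨η, ?_⟩
  rw [mem_spec] at hη ⊢
  rwa [sum_splitKernel]

/-- Chebotarev on the slice at `y`. A frequency `ξ` of one slice occurs in the whole spectrum: the
transformed slices form a nonzero function of `y`, whose `Q`-transform is nonzero somewhere. -/
theorem le_card_column_add (hP : IsChebotarev P) (hQ : IsChebotarev Q) (hu : ∀ ξ y, u ξ y ≠ 0)
    {y : Y} (hy : y ∈ suppImage f) :
    Fintype.card X + 1 ≤ #{z ∈ supp f | z.2 = y} + #(specImage P u Q f) := by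
  obtain ⟨x, hx⟩ := mem_suppImage.1 hy
  have h1 := hP (fun x => f (x, y)) (fun h => hx (congrFun h x))
  rw [card_filter_snd_eq]
  refine h1.trans (Nat.add_le_add_left (card_le_card ?_) _)
  intro ξ hξ
  exact mem_specImage_of_ne_zero hQ hu (mem_spec.1 hξ)

/-- Chebotarev for `Q`, applied to the function of `y` made of the transformed slices at `ξ`; it
vanishes off `suppImage f`. -/
theorem le_card_row_add (hQ : IsChebotarev Q) {ξ : Ξ} (hξ : ξ ∈ specImage P u Q f) :
    Fintype.card Y + 1 ≤ #(suppImage f) + #{ζ ∈ spec (splitKernel P u Q) f | ζ.1 = ξ} := by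
  obtain ⟨η, hη⟩ := mem_specImage.1 hξ
  rw [mem_spec, sum_splitKernel] at hη
  have h1 := hQ (fun y => u ξ y * ∑ x, P ξ x * f (x, y)) (by
    intro h0
    apply hη
    refine Finset.sum_eq_zero fun y _ => ?_
    have := congrFun h0 y
    simp only [Pi.zero_apply] at this
    simp [this])
  rw [card_filter_fst_eq]
  refine h1.trans (Nat.add_le_add_right (card_le_card ?_) _)
  intro y hy
  rw [mem_suppImage]
  by_contra! h
  simp [h] at hy

theorem card_row_le (ξ : Ξ) :
    #{ζ ∈ spec (splitKernel P u Q) f | ζ.1 = ξ} ≤ Fintype.card N := by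
  rw [card_filter_fst_eq]
  exact card_le_univ _

theorem card_column_le (y : Y) : #{z ∈ supp f | z.2 = y} ≤ Fintype.card X := by
  rw [card_filter_snd_eq]
  exact card_le_univ _

theorem suppImage_nonempty (hf : f ≠ 0) : (suppImage f).Nonempty :=
  (supp_nonempty hf).image _

theorem specImage_nonempty (hP : IsChebotarev P) (hQ : IsChebotarev Q) (hu : ∀ ξ y, u ξ y ≠ 0)
    (hf : f ≠ 0) : (specImage P u Q f).Nonempty := by
  obtain ⟨y, hy⟩ := suppImage_nonempty hf
  have h1 := le_card_column_add hP hQ hu hy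
  have h2 := card_column_le (f := f) y
  rw [← card_pos]
  omega

/-- Functions carried by one coset. -/
theorem IsExtremal.card_spec_le_of_le (hf : IsExtremal (splitKernel P u Q) f)
    (hX : Fintype.card Ξ = Fintype.card X) {a : ℕ} (ha : 1 ≤ a) (haX : a ≤ Fintype.card X)
    (hak : a ≤ #(supp f)) :
    #(spec (splitKernel P u Q) f) ≤ Fintype.card N * (Fintype.card X + 1 - a) := by
  obtain ⟨⟨x₀, y₀⟩, -⟩ := supp_nonempty hf.1
  obtain ⟨C, -, hC⟩ := exists_subset_card_eq (s := (univ : Finset X)) (by simpa using haX)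
  obtain ⟨R, -, hR⟩ := exists_subset_card_eq (s := (univ : Finset Ξ)) (n := a - 1)
    (by rw [card_univ, hX]; omega)
  obtain ⟨g, hg0, hgC, hgR⟩ := exists_ne_zero_of_card_lt (K := P) C R (by omega)
  refine (hf.2 (fun z => if z.2 = y₀ then g z.1 else 0) ?_ ?_).trans ?_
  · intro h
    apply hg0
    funext x
    simpa using congrFun h (x, y₀)
  · refine le_trans ?_ hak
    rw [← hC]
    refine (card_le_card ?_).trans (card_image_le (s := C) (f := fun x => (x, y₀)))
    rintro ⟨x, y⟩ h
    rw [mem_supp] at h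
    simp only [ne_eq, ite_eq_right_iff, Classical.not_imp] at h
    obtain ⟨rfl, h⟩ := h
    refine mem_image_of_mem _ ?_
    by_contra hx
    exact h (hgC x hx)
  · have hsub : spec (splitKernel P u Q) (fun z => if z.2 = y₀ then g z.1 else 0) ⊆
        Rᶜ ×ˢ univ := by
      rintro ⟨ξ, η⟩ h
      rw [mem_spec, sum_splitKernel] at h
      simp only [mem_product, mem_compl, mem_univ, and_true]
      intro hξ
      apply h
      refine Finset.sum_eq_zero fun y _ => ?_
      by_cases hy : y = y₀
      · simp [hy, hgR ξ hξ]
      · simp [hy]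
    refine (card_le_card hsub).trans ?_
    rw [card_product, card_compl, card_univ, hX, hR, mul_comm]
    refine Nat.mul_le_mul_left _ ?_
    omega

/-- Functions that are constant on cosets, up to a character. -/
theorem IsExtremal.card_spec_le_of_mul_le (hf : IsExtremal (splitKernel P u Q) f)
    (hu : ∀ ξ y, u ξ y ≠ 0)
    (hX : Fintype.card Ξ = Fintype.card X) (hY : Fintype.card N = Fintype.card Y)
    {b : ℕ} (hb : 1 ≤ b) (hbY : b ≤ Fintype.card Y)
    (hbk : Fintype.card X * b ≤ #(supp f)) :
    #(spec (splitKernel P u Q) f) ≤ Fintype.card Y + 1 - b := by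
  obtain ⟨⟨x₀, y₀⟩, -⟩ := supp_nonempty hf.1
  have hXpos : 0 < Fintype.card X := Fintype.card_pos_iff.2 ⟨x₀⟩
  have hΞ : Nonempty Ξ := by rw [← Fintype.card_pos_iff, hX]; exact hXpos
  obtain ⟨ξ₀⟩ := hΞ
  obtain ⟨C, -, hC⟩ := exists_subset_card_eq (s := (univ : Finset Y)) (by simpa using hbY)
  obtain ⟨R, -, hR⟩ := exists_subset_card_eq (s := (univ : Finset N)) (n := b - 1)
    (by rw [card_univ, hY]; omega)
  obtain ⟨g, hg0, hgC, hgR⟩ := exists_ne_zero_of_card_lt (K := Q) C R (by omega)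
  obtain ⟨v, hv0, -, hv⟩ := exists_ne_zero_of_card_lt (K := P) univ {ξ₀}ᶜ (by
    rw [card_compl, card_univ, card_singleton, hX]; omega)
  -- The factor `v` confines the spectrum to `ξ₀`; division by the twist leaves there the
  -- `Q`-transform of `g`, which vanishes at the `b - 1` points of `R`.
  refine (hf.2 (fun z => v z.1 * (g z.2 / u ξ₀ z.2)) ?_ ?_).trans ?_
  · intro h
    obtain ⟨x, hx⟩ := Function.ne_iff.1 hv0
    obtain ⟨y, hy⟩ := Function.ne_iff.1 hg0
    exact mul_ne_zero hx (div_ne_zero hy (hu ξ₀ y)) (congrFun h (x, y))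
  · refine le_trans ?_ hbk
    rw [← hC, ← card_univ, ← card_product]
    refine card_le_card ?_
    rintro ⟨x, y⟩ h
    rw [mem_supp] at h
    simp only [mem_product, mem_univ, true_and]
    by_contra hy
    exact h (by simp [hgC y hy])
  · have hsub : spec (splitKernel P u Q) (fun z => v z.1 * (g z.2 / u ξ₀ z.2)) ⊆
        {ξ₀} ×ˢ Rᶜ := by
      rintro ⟨ξ, η⟩ h
      rw [mem_spec, sum_splitKernel] at h
      simp only [← mul_assoc, ← Finset.sum_mul] at h
      by_cases hξ : ξ = ξ₀
      · subst hξ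
        simp only [mem_product, mem_singleton, mem_compl, true_and]
        intro hη
        apply h
        have h1 := hgR η hη
        have h2 : ∀ y, Q η y * (u ξ y * ((∑ x, P ξ x * v x) * (g y / u ξ y))) =
            (∑ x, P ξ x * v x) * (Q η y * g y) := by
          intro y
          have := hu ξ y
          field_simp
        rw [← mul_zero (∑ x, P ξ x * v x), ← h1, Finset.mul_sum]
        refine Finset.sum_congr rfl fun y _ => ?_
        rw [← h2 y]
        ring
      · exfalso
        apply h
        refine Finset.sum_eq_zero fun y _ => ?_
        have := hv ξ (by simpa using hξ)
        simp [this]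
    refine (card_le_card hsub).trans ?_
    rw [card_product, card_compl, card_singleton, hY, hR]
    omega

/-- Extremal functions carried by one coset. -/
theorem hasRankOnePartition_of_card_suppImage_eq_one (hf : IsExtremal (splitKernel P u Q) f)
    (hP : IsChebotarev P) (hQ : IsChebotarev Q) (hu : ∀ ξ y, u ξ y ≠ 0)
    (hX : Fintype.card Ξ = Fintype.card X) (hY : Fintype.card N = Fintype.card Y)
    (hS : #(suppImage f) = 1) : HasRankOnePartition (splitKernel P u Q) f := by
  obtain ⟨y₀, hy₀⟩ := card_eq_one.1 hS
  have hk : #(supp f) = #{z ∈ supp f | z.2 = y₀} := by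
    rw [card_supp_eq_sum, hy₀, sum_singleton]
  have hkX : #(supp f) ≤ Fintype.card X := hk ▸ card_column_le y₀
  have hk1 := card_pos.2 (supp_nonempty hf.1)
  have hB := hf.card_spec_le_of_le hX hk1 hkX le_rfl
  have hcol := le_card_column_add hP hQ hu (y := y₀) (f := f) (by simp [hy₀])
  rw [← hk] at hcol
  set T := specImage P u Q f with hT
  have hrow : ∀ ξ ∈ T, #{ζ ∈ spec (splitKernel P u Q) f | ζ.1 = ξ} = Fintype.card N := by
    intro ξ hξ
    have h1 := le_card_row_add hQ hξ
    have h2 := card_row_le (P := P) (u := u) (Q := Q) (f := f) ξ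
    omega
  have hcard : #(spec (splitKernel P u Q) f) = #T * Fintype.card N := by
    rw [card_spec_eq_sum, sum_congr rfl hrow, sum_const, smul_eq_mul]
  have hNpos : 0 < Fintype.card N := by
    rw [hY]; exact Fintype.card_pos_iff.2 ⟨y₀⟩
  have hTle : #T ≤ Fintype.card X + 1 - #(supp f) := by
    rw [hcard, mul_comm] at hB
    exact Nat.le_of_mul_le_mul_left hB hNpos
  have hspec : spec (splitKernel P u Q) f = T ×ˢ univ := by
    refine eq_of_subset_of_card_le ?_ ?_
    · intro ζ hζ
      simp only [mem_product, mem_univ, and_true]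
      exact mem_image_of_mem _ hζ
    · rw [hcard, card_product, card_univ]
  have hcompl : (spec (splitKernel P u Q) f)ᶜ =
      Tᶜ.biUnion fun ξ => ({ξ} : Finset Ξ) ×ˢ (univ : Finset N) := by
    rw [hspec]
    ext ⟨ξ, η⟩
    simp
  -- The bounds of Chebotarev and of the competitor meet at `#T = |X| + 1 - #(supp f)`, so `#(supp
  -- f) - 1` full rows remain, each of rank one.
  have hN : #(supp f) - 1 = #Tᶜ * 1 := by
    rw [card_compl, hX]
    omega
  rw [HasRankOnePartition, hcompl, hN]
  refine RankOnePartition.biUnion_rows _ _ _ ?_ ?_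
  · intro ξ _ ξ' _ h
    rw [Function.onFun, disjoint_left]
    rintro ⟨a, b⟩ h1 h2
    simp only [mem_product, mem_singleton, mem_univ, and_true] at h1 h2
    exact h (h1.symm.trans h2)
  · intro ξ _
    have : Nonempty N := Fintype.card_pos_iff.1 hNpos
    refine RankOnePartition.block ((singleton_nonempty ξ).product univ_nonempty)
      (supp_nonempty hf.1) (fun ζ => u ξ y₀ * Q ζ.2 y₀) (fun z => P ξ z.1) ?_
    rintro ⟨ξ', η⟩ h ⟨x, y⟩ hz
    simp only [mem_product, mem_singleton, mem_univ, and_true] at h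
    have hy : y ∈ suppImage f := mem_image_of_mem Prod.snd hz
    rw [hy₀, mem_singleton] at hy
    subst h hy
    simp only [splitKernel]
    ring

/-- Extremal functions with spectrum in one coset. -/
theorem hasRankOnePartition_of_card_specImage_eq_one (hf : IsExtremal (splitKernel P u Q) f)
    (hP : IsChebotarev P) (hQ : IsChebotarev Q) (hu : ∀ ξ y, u ξ y ≠ 0)
    (hX : Fintype.card Ξ = Fintype.card X) (hY : Fintype.card N = Fintype.card Y)
    (hT : #(specImage P u Q f) = 1) : HasRankOnePartition (splitKernel P u Q) f := by
  obtain ⟨ξ₀, hξ₀⟩ := card_eq_one.1 hT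
  set S := suppImage f with hS
  have hcol : ∀ y ∈ S, #{z ∈ supp f | z.2 = y} = Fintype.card X := by
    intro y hy
    have h1 := le_card_column_add hP hQ hu hy
    have h2 := card_column_le (f := f) y
    omega
  have hk : #(supp f) = Fintype.card X * #S := by
    rw [card_supp_eq_sum, sum_congr rfl hcol, sum_const, smul_eq_mul, mul_comm]
  have hS1 : 1 ≤ #S := card_pos.2 (suppImage_nonempty hf.1)
  have hSY : #S ≤ Fintype.card Y := card_le_univ _
  have hB := hf.card_spec_le_of_mul_le hu hX hY hS1 hSY hk.ge
  have hrow := le_card_row_add hQ (P := P) (u := u) (Q := Q) (ξ := ξ₀) (f := f) (by simp [hξ₀])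
  rw [← hS] at hrow
  have hB2 : #(spec (splitKernel P u Q) f) =
      #{ζ ∈ spec (splitKernel P u Q) f | ζ.1 = ξ₀} := by
    rw [card_spec_eq_sum, hξ₀, sum_singleton]
  have hsupp : supp f = S.biUnion fun y => (univ : Finset X) ×ˢ ({y} : Finset Y) := by
    have h1 : S.biUnion (fun y => (univ : Finset X) ×ˢ ({y} : Finset Y)) = univ ×ˢ S := by
      ext ⟨x, y⟩; simp
    rw [h1]
    refine eq_of_subset_of_card_le ?_ ?_
    · intro z hz
      simp only [mem_product, mem_univ, true_and]
      exact mem_image_of_mem _ hz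
    · rw [hk, card_product, card_univ]
  have hspec : ∀ ζ ∈ spec (splitKernel P u Q) f, ζ.1 = ξ₀ := by
    intro ζ hζ
    have : ζ.1 ∈ specImage P u Q f := mem_image_of_mem _ hζ
    simpa [hξ₀] using this
  have hcompl : (spec (splitKernel P u Q) f)ᶜ =
      (({ξ₀}ᶜ : Finset Ξ).biUnion fun ξ => ({ξ} : Finset Ξ) ×ˢ (univ : Finset N)) ∪
        ({ξ₀} ×ˢ univ) \ spec (splitKernel P u Q) f := by
    ext ⟨ξ, η⟩
    simp only [mem_compl, mem_union, mem_biUnion, mem_product, mem_singleton, mem_univ, and_true,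
      mem_sdiff]
    constructor
    · intro h
      by_cases h1 : ξ = ξ₀
      · exact Or.inr ⟨h1, h⟩
      · exact Or.inl ⟨ξ, h1, rfl⟩
    · rintro (⟨ξ', h1, rfl⟩ | h) h2
      · exact h1 (hspec _ h2)
      · exact h.2 h2
  have hXpos : 1 ≤ Fintype.card X := by
    obtain ⟨⟨x₀, -⟩, -⟩ := supp_nonempty hf.1
    exact Fintype.card_pos_iff.2 ⟨x₀⟩
  have hNpos : 0 < Fintype.card N := by omega
  have hsub : spec (splitKernel P u Q) f ⊆ ({ξ₀} : Finset Ξ) ×ˢ (univ : Finset N) := by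
    rintro ⟨ξ, η⟩ hζ
    simpa using (hspec _ hζ).symm
  -- The `|X| - 1` rows `ξ ≠ ξ₀` are cut into `#S` cosets each, and `#S - 1` single rows remain over
  -- `ξ₀`: in all `|X| · #S - 1`.
  have hN : #(supp f) - 1 = #({ξ₀}ᶜ : Finset Ξ) * (#S * 1) +
      #((({ξ₀} : Finset Ξ) ×ˢ (univ : Finset N)) \ spec (splitKernel P u Q) f) := by
    rw [card_sdiff_of_subset hsub, card_product, card_compl, card_singleton, card_univ, hk, hX, hY]
    have h3 : #(spec (splitKernel P u Q) f) = Fintype.card Y + 1 - #S := by omega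
    rw [h3, Nat.sub_mul, mul_one]
    have : #S ≤ Fintype.card X * #S := Nat.le_mul_of_pos_left _ hXpos
    omega
  rw [HasRankOnePartition, hcompl, hN]
  refine RankOnePartition.union_rows ?_ (RankOnePartition.biUnion_rows _ _ _ ?_ ?_)
    (RankOnePartition.single_rows _ (supp_nonempty hf.1))
  · rw [disjoint_left]
    rintro ⟨ξ, η⟩ h1 h2
    simp at h1 h2
    exact h1 h2.1.symm
  · intro ξ _ ξ' _ h
    rw [Function.onFun, disjoint_left]
    rintro ⟨a, b⟩ h1 h2
    simp only [mem_product, mem_singleton, mem_univ, and_true] at h1 h2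
    exact h (h1.symm.trans h2)
  · intro ξ _
    rw [hsupp]
    refine RankOnePartition.biUnion_cols _ _ _ ?_ ?_
    · intro y _ y' _ h
      rw [Function.onFun, disjoint_left]
      rintro ⟨a, b⟩ h1 h2
      simp only [mem_product, mem_singleton, mem_univ, true_and] at h1 h2
      exact h (h1.symm.trans h2)
    · intro y _
      have : Nonempty N := Fintype.card_pos_iff.1 hNpos
      have : Nonempty X := Fintype.card_pos_iff.1 hXpos
      refine RankOnePartition.block ((singleton_nonempty ξ).product univ_nonempty)
        (univ_nonempty.product (singleton_nonempty y))
        (fun ζ => u ξ y * Q ζ.2 y) (fun z => P ξ z.1) ?_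
      rintro ⟨ξ', η⟩ h ⟨x, y'⟩ hz
      simp only [mem_product, mem_singleton, mem_univ, and_true, true_and] at h hz
      subst h hz
      simp only [splitKernel]
      ring

end SplitKernel

/-! ### Extremal functions lie on the boundary -/

section Classification

/-- Meshulam's extremal rectangles are never in the interior. -/
theorem boundary_of_competitors {p q c s t r k θ : ℕ} (hpq : p ≤ q) (hc : 1 ≤ c) (ht : 1 ≤ t)
    (hct : c + t = p + 1) (hs : 1 ≤ s) (hr : 1 ≤ r) (hsr : s + r = q + 1) (hk : s * c ≤ k)
    (hθ : t * r ≤ θ)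
    (e₁ : ∀ a a', 1 ≤ a → 1 ≤ a' → a + a' = p + 1 → a ≤ k → θ ≤ q * a')
    (e₂ : ∀ b b', 1 ≤ b → 1 ≤ b' → b + b' = q + 1 → p * b ≤ k → θ ≤ b')
    (e₃ : ∀ b b', 1 ≤ b → 1 ≤ b' → b + b' = q + 1 → b ≤ k → θ ≤ p * b')
    (e₄ : ∀ a a', 1 ≤ a → 1 ≤ a' → a + a' = p + 1 → q * a ≤ k → θ ≤ a') :
    c = 1 ∨ t = 1 ∨ s = 1 ∨ r = 1 := by
  by_contra! hne
  obtain ⟨h1, h2, h3, h4⟩ := hne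
  obtain ⟨c, rfl⟩ : ∃ c', c = c' + 2 := ⟨c - 2, by omega⟩
  obtain ⟨t, rfl⟩ : ∃ t', t = t' + 2 := ⟨t - 2, by omega⟩
  obtain ⟨s, rfl⟩ : ∃ s', s = s' + 2 := ⟨s - 2, by omega⟩
  obtain ⟨r, rfl⟩ : ∃ r', r = r' + 2 := ⟨r - 2, by omega⟩
  obtain rfl : p = c + t + 3 := by omega
  obtain rfl : q = s + r + 3 := by omega
  -- All of `c, t, s, r` are now diminished by two. In the original variables, cases A, B and C take
  -- `a = c + s - 1`, `a = c - r + 1` and `b = s - t + 1`. The products are compared through `(x +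
  -- e)(y - e) = xy - e(x + e - y)`, where `x + e` is `q`, `q` and `p` respectively.
  by_cases hA : c + s + 3 ≤ c + t + 3
  · obtain ⟨d, rfl⟩ : ∃ d, t = s + d := ⟨t - s, by omega⟩
    have := e₁ (c + s + 3) (d + 1) (by omega) (by omega) (by omega) (by nlinarith)
    nlinarith
  by_cases hB : s + r + 3 + 1 ≤ c + s + 4
  · obtain ⟨d, rfl⟩ : ∃ d, c = r + d := ⟨c - r, by omega⟩
    have := e₄ (d + 1) (t + r + 3) (by omega) (by omega) (by omega) (by nlinarith)
    nlinarith
  by_cases hC : s + 2 ≤ c + t + 3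
  · obtain ⟨d, hd⟩ : ∃ d, s = t + d + 1 := ⟨s - t - 1, by omega⟩
    obtain ⟨d', hd'⟩ : ∃ d', c + 1 = d + d' := ⟨c + 1 - d, by omega⟩
    have := e₂ (d + 2) (t + r + 3) (by omega) (by omega) (by omega) (by nlinarith)
    nlinarith
  by_cases hD : 2 * (s + 2) < s + r + 5
  · have := e₂ 1 (s + r + 3) (by omega) (by omega) (by omega) (by nlinarith)
    nlinarith
  by_cases hE : (s + 2) * (c + 2) ≤ s + r + 3
  · obtain ⟨d, hd⟩ : ∃ d, (s + 2) * (c + 2) + d = s + r + 3 := ⟨_, Nat.add_sub_cancel' hE⟩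
    have := e₃ ((s + 2) * (c + 2)) (d + 1) (by nlinarith) (by omega) (by omega) hk
    nlinarith
  · have := e₃ (s + r + 3) 1 (by omega) (by omega) (by omega) (by omega)
    have h5 : c + 1 ≤ r := by omega
    nlinarith

variable {X Y Ξ N : Type*} [Fintype X] [Fintype Y] [Fintype Ξ] [Fintype N]
  [DecidableEq X] [DecidableEq Y] [DecidableEq Ξ] [DecidableEq N]
  {P : Ξ → X → ℂ} {u : Ξ → Y → ℂ} {Q : N → Y → ℂ} {f : X × Y → ℂ}

theorem mul_le_card_supp (hP : IsChebotarev P) (hQ : IsChebotarev Q) (hu : ∀ ξ y, u ξ y ≠ 0) :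
    #(suppImage f) * (Fintype.card X + 1 - #(specImage P u Q f)) ≤ #(supp f) := by
  rw [card_supp_eq_sum, ← smul_eq_mul]
  refine card_nsmul_le_sum _ _ _ fun y hy => ?_
  have := le_card_column_add hP hQ hu hy
  omega

theorem mul_le_card_spec (hQ : IsChebotarev Q) :
    #(specImage P u Q f) * (Fintype.card Y + 1 - #(suppImage f)) ≤
      #(spec (splitKernel P u Q) f) := by
  rw [card_spec_eq_sum, ← smul_eq_mul]
  refine card_nsmul_le_sum _ _ _ fun y hy => ?_
  have := le_card_row_add hQ hy
  omega

theorem card_suppImage_le_card_supp (f : X × Y → ℂ) : #(suppImage f) ≤ #(supp f) :=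
  card_image_le

theorem card_specImage_le_card_spec :
    #(specImage P u Q f) ≤ #(spec (splitKernel P u Q) f) := card_image_le

theorem injOn_snd_of_card_le (h : #(supp f) ≤ #(suppImage f)) :
    Set.InjOn Prod.snd (supp f : Set (X × Y)) :=
  card_image_iff.1 (le_antisymm card_image_le h)

theorem injOn_fst_of_card_le (h : #(spec (splitKernel P u Q) f) ≤ #(specImage P u Q f)) :
    Set.InjOn Prod.fst (spec (splitKernel P u Q) f : Set (Ξ × N)) :=
  card_image_iff.1 (le_antisymm card_image_le h)

/-- The possible extremal functions when the two factors have the same order. -/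
theorem IsExtremal.cases_of_card_eq (hf : IsExtremal (splitKernel P u Q) f)
    (hP : IsChebotarev P) (hQ : IsChebotarev Q) (hu : ∀ ξ y, u ξ y ≠ 0) {p : ℕ}
    (hX : Fintype.card X = p) (hY : Fintype.card Y = p) (hΞ : Fintype.card Ξ = p)
    (hN : Fintype.card N = p) :
    HasRankOnePartition (splitKernel P u Q) f ∨
    (2 ≤ #(supp f) ∧ #(supp f) < p ∧ Set.InjOn Prod.snd (supp f : Set (X × Y)) ∧
      #(spec (splitKernel P u Q) f) = p * (p + 1 - #(supp f))) ∨
    (2 ≤ #(spec (splitKernel P u Q) f) ∧ #(spec (splitKernel P u Q) f) ≤ p ∧ p ≤ #(supp f) ∧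
      Set.InjOn Prod.fst (spec (splitKernel P u Q) f : Set (Ξ × N)) ∧
      #(supp f) < p * (p + 2 - #(spec (splitKernel P u Q) f))) := by
  have hS1 : 1 ≤ #(suppImage f) := card_pos.2 (suppImage_nonempty hf.1)
  have hSp : #(suppImage f) ≤ p := hY ▸ card_le_univ _
  have hT1 : 1 ≤ #(specImage P u Q f) := card_pos.2 (specImage_nonempty hP hQ hu hf.1)
  have hTp : #(specImage P u Q f) ≤ p := hΞ ▸ card_le_univ _
  have hk := mul_le_card_supp (f := f) hP hQ hu
  have hθ := mul_le_card_spec (P := P) (u := u) (f := f) hQ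
  have hSk := card_suppImage_le_card_supp f
  have hTθ := card_specImage_le_card_spec (P := P) (u := u) (Q := Q) (f := f)
  have e₁ : ∀ a a', 1 ≤ a → 1 ≤ a' → a + a' = p + 1 → a ≤ #(supp f) →
      #(spec (splitKernel P u Q) f) ≤ p * a' := by
    intro a a' h1 h2 h3 h4
    have := hf.card_spec_le_of_le (hΞ.trans hX.symm) h1 (by omega) h4
    rwa [hN, hX, show p + 1 - a = a' by omega] at this
  have e₂ : ∀ b b', 1 ≤ b → 1 ≤ b' → b + b' = p + 1 → p * b ≤ #(supp f) →
      #(spec (splitKernel P u Q) f) ≤ b' := by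
    intro b b' h1 h2 h3 h4
    have := hf.card_spec_le_of_mul_le hu (hΞ.trans hX.symm) (hN.trans hY.symm) h1 (by omega)
      (by rwa [hX])
    omega
  rw [hX] at hk
  rw [hY] at hθ
  by_cases hs : #(suppImage f) = 1
  · exact Or.inl (hasRankOnePartition_of_card_suppImage_eq_one hf hP hQ hu (hΞ.trans hX.symm)
      (hN.trans hY.symm) hs)
  by_cases ht : #(specImage P u Q f) = 1
  · exact Or.inl (hasRankOnePartition_of_card_specImage_eq_one hf hP hQ hu (hΞ.trans hX.symm)
      (hN.trans hY.symm) ht)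
  right
  generalize hs' : #(suppImage f) = s at *
  generalize ht' : #(specImage P u Q f) = t at *
  generalize hkk : #(supp f) = k at *
  generalize hθθ : #(spec (splitKernel P u Q) f) = θ at *
  have hb := boundary_of_competitors (p := p) (q := p) (c := p + 1 - t) (s := s) (t := t)
    (r := p + 1 - s) (k := k) (θ := θ) le_rfl (by omega) hT1 (by omega) hS1
    (by omega) (by omega) hk hθ e₁ e₂ e₁ e₂
  by_cases hsp : s = p
  · right
    have h1 : θ ≤ t := e₂ (p + 1 - t) t (by omega) hT1 (by omega) (by rwa [hsp] at hk)
    refine ⟨by omega, by omega, by omega,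
      injOn_fst_of_card_le (by rw [hθθ, ht']; exact h1), ?_⟩
    by_contra! h2
    have := e₂ (p + 2 - t) (t - 1) (by omega) (by omega) (by omega)
      (by rwa [show θ = t by omega] at h2)
    omega
  · left
    have htp : t = p := by omega
    subst htp
    -- With `s + 1` points a function on one coset would have spectrum at most `p(p - s)`, below the
    -- lower bound `p(p + 1 - s)`.
    have h1 : k = s := by
      by_contra hne
      have h2 := e₁ (s + 1) (t - s) (by omega) (by omega) (by omega) (by omega)
      have h3 : t * (t - s) < t * (t + 1 - s) := Nat.mul_lt_mul_of_pos_left (by omega) (by omega)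
      omega
    have h2 := e₁ s (t + 1 - s) (by omega) (by omega) (by omega) hSk
    refine ⟨by omega, by omega, injOn_snd_of_card_le (by rw [hkk, hs', h1]), ?_⟩
    rw [h1]
    omega

/-- The possible extremal functions when the two factors have different orders. -/
theorem IsExtremal.cases_of_card_lt (hf : IsExtremal (splitKernel P (fun _ _ => 1) Q) f)
    (hP : IsChebotarev P) (hQ : IsChebotarev Q) {p q : ℕ} (hpq : p < q) (hcop : p.Coprime q)
    (hX : Fintype.card X = p) (hY : Fintype.card Y = q) (hΞ : Fintype.card Ξ = p)
    (hN : Fintype.card N = q) :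
    HasRankOnePartition (splitKernel P (fun _ _ => 1) Q) f ∨
    (Set.InjOn Prod.snd (supp f : Set (X × Y)) ∧
      Set.InjOn Prod.snd (spec (splitKernel P (fun _ _ => 1) Q) f : Set (Ξ × N))) ∨
    (2 ≤ #(spec (splitKernel P (fun _ _ => 1) Q) f) ∧
      #(spec (splitKernel P (fun _ _ => 1) Q) f) ≤ p ∧
      Set.InjOn Prod.fst (spec (splitKernel P (fun _ _ => 1) Q) f : Set (Ξ × N)) ∧
      Set.InjOn Prod.snd (spec (splitKernel P (fun _ _ => 1) Q) f : Set (Ξ × N)) ∧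
      #(supp f) < q * (p + 2 - #(spec (splitKernel P (fun _ _ => 1) Q) f))) := by
  set K := splitKernel P (fun _ _ => 1) Q with hK
  -- The same transform with the two factors exchanged; it provides the competitors `e₃`, `e₄` and a
  -- second pair of counts `s'`, `t'`.
  set K' := splitKernel Q (fun _ _ => 1) P with hK'
  have hKK : (fun i j => K (Equiv.prodComm _ _ i) (Equiv.prodComm _ _ j)) = K' := by
    funext i j
    simp only [hK, hK', splitKernel, Equiv.prodComm_apply, Prod.fst_swap, Prod.snd_swap]
    ring
  set g : Y × X → ℂ := f ∘ Equiv.prodComm _ _ with hg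
  have hgext : IsExtremal K' g := by
    rw [← hKK]; exact hf.comp_equiv _ _
  have hksupp : #(supp g) = #(supp f) := card_supp_comp_equiv _ f
  have hkspec : #(spec K' g) = #(spec K f) := by
    rw [← hKK]; exact card_spec_comp_equiv _ _ K f
  have hgood : HasRankOnePartition K' g → HasRankOnePartition K f := by
    intro h
    rw [← hKK] at h
    exact h.of_comp_equiv _ _
  have hu : ∀ (ξ : Ξ) (y : Y), (fun _ _ => 1 : Ξ → Y → ℂ) ξ y ≠ 0 := fun _ _ => one_ne_zero
  have hu' : ∀ (ξ : N) (y : X), (fun _ _ => 1 : N → X → ℂ) ξ y ≠ 0 := fun _ _ => one_ne_zero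
  have hS1 : 1 ≤ #(suppImage f) := card_pos.2 (suppImage_nonempty hf.1)
  have hSq : #(suppImage f) ≤ q := hY ▸ card_le_univ _
  have hT1 : 1 ≤ #(specImage P (fun _ _ => 1) Q f) :=
    card_pos.2 (specImage_nonempty hP hQ hu hf.1)
  have hTp : #(specImage P (fun _ _ => 1) Q f) ≤ p := hΞ ▸ card_le_univ _
  have hk := mul_le_card_supp (f := f) hP hQ hu
  have hθ := mul_le_card_spec (P := P) (u := fun _ _ => 1) (f := f) hQ
  have hSk := card_suppImage_le_card_supp f
  have hTθ := card_specImage_le_card_spec (P := P) (u := fun _ _ => 1) (Q := Q) (f := f)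
  have hS1' : 1 ≤ #(suppImage g) := card_pos.2 (suppImage_nonempty hgext.1)
  have hSp' : #(suppImage g) ≤ p := hX ▸ card_le_univ _
  have hT1' : 1 ≤ #(specImage Q (fun _ _ => 1) P g) :=
    card_pos.2 (specImage_nonempty hQ hP hu' hgext.1)
  have hTq' : #(specImage Q (fun _ _ => 1) P g) ≤ q := hN ▸ card_le_univ _
  have hk' := mul_le_card_supp (f := g) hQ hP hu'
  have hθ' := mul_le_card_spec (P := Q) (u := fun _ _ => 1) (f := g) hP
  have hSk' := card_suppImage_le_card_supp g
  have hTθ' := card_specImage_le_card_spec (P := Q) (u := fun _ _ => 1) (Q := P) (f := g)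
  have e₁ : ∀ a a', 1 ≤ a → 1 ≤ a' → a + a' = p + 1 → a ≤ #(supp f) →
      #(spec K f) ≤ q * a' := by
    intro a a' h1 h2 h3 h4
    have := hf.card_spec_le_of_le (hΞ.trans hX.symm) h1 (by omega) h4
    rwa [hN, hX, show p + 1 - a = a' by omega] at this
  have e₂ : ∀ b b', 1 ≤ b → 1 ≤ b' → b + b' = q + 1 → p * b ≤ #(supp f) →
      #(spec K f) ≤ b' := by
    intro b b' h1 h2 h3 h4
    have := hf.card_spec_le_of_mul_le hu (hΞ.trans hX.symm) (hN.trans hY.symm) h1 (by omega)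
      (by rwa [hX])
    rw [← hK] at this
    omega
  have e₃ : ∀ b b', 1 ≤ b → 1 ≤ b' → b + b' = q + 1 → b ≤ #(supp f) →
      #(spec K f) ≤ p * b' := by
    intro b b' h1 h2 h3 h4
    have := hgext.card_spec_le_of_le (hN.trans hY.symm) h1 (by omega) (by rwa [hksupp])
    rwa [hΞ, hY, ← hK', hkspec, show q + 1 - b = b' by omega] at this
  have e₄ : ∀ a a', 1 ≤ a → 1 ≤ a' → a + a' = p + 1 → q * a ≤ #(supp f) →
      #(spec K f) ≤ a' := by
    intro b b' h1 h2 h3 h4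
    have := hgext.card_spec_le_of_mul_le hu' (hN.trans hY.symm) (hΞ.trans hX.symm) h1 (by omega)
      (by rwa [hY, hksupp])
    rw [← hK', hkspec] at this
    omega
  rw [hX] at hk
  rw [hY, ← hK] at hθ
  rw [hY, hksupp] at hk'
  rw [hX, ← hK', hkspec] at hθ'
  rw [hksupp] at hSk'
  rw [← hK', hkspec] at hTθ'
  rw [← hK] at hTθ
  by_cases hs : #(suppImage f) = 1
  · exact Or.inl (hasRankOnePartition_of_card_suppImage_eq_one hf hP hQ hu (hΞ.trans hX.symm)
      (hN.trans hY.symm) hs)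
  by_cases ht : #(specImage P (fun _ _ => 1) Q f) = 1
  · exact Or.inl (hasRankOnePartition_of_card_specImage_eq_one hf hP hQ hu (hΞ.trans hX.symm)
      (hN.trans hY.symm) ht)
  by_cases hs' : #(suppImage g) = 1
  · exact Or.inl (hgood (hasRankOnePartition_of_card_suppImage_eq_one hgext hQ hP hu'
      (hN.trans hY.symm) (hΞ.trans hX.symm) hs'))
  by_cases ht' : #(specImage Q (fun _ _ => 1) P g) = 1
  · exact Or.inl (hgood (hasRankOnePartition_of_card_specImage_eq_one hgext hQ hP hu'
      (hN.trans hY.symm) (hΞ.trans hX.symm) ht'))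
  right
  have hsnd : #(spec K f) ≤ #(specImage Q (fun _ _ => 1) P g) →
      Set.InjOn Prod.snd (spec K f : Set (Ξ × N)) := by
    intro h
    rw [← hkspec] at h
    have hinj := injOn_fst_of_card_le h
    rw [← hK', ← hKK] at hinj
    intro ζ hζ ζ' hζ' he
    have hm : ∀ ζ ∈ spec K f,
        ζ.swap ∈ spec (fun i j => K (Equiv.prodComm _ _ i) (Equiv.prodComm _ _ j)) g := by
      intro ζ hζ
      have := spec_comp_equiv (Equiv.prodComm N Ξ) (Equiv.prodComm Y X) K f
      rw [← this] at hζ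
      obtain ⟨i, hi, rfl⟩ := mem_map.1 hζ
      exact hi
    exact Prod.swap_injective (hinj (hm ζ hζ) (hm ζ' hζ') he)
  have hsndsupp : #(supp f) ≤ #(suppImage f) → Set.InjOn Prod.snd (supp f : Set (X × Y)) :=
    injOn_snd_of_card_le
  have hfst : #(spec K f) ≤ #(specImage P (fun _ _ => 1) Q f) →
      Set.InjOn Prod.fst (spec K f : Set (Ξ × N)) := injOn_fst_of_card_le
  generalize #(suppImage f) = s at *
  generalize #(specImage P (fun _ _ => 1) Q f) = t at *
  generalize #(suppImage g) = s' at *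
  generalize #(specImage Q (fun _ _ => 1) P g) = t' at *
  generalize #(supp f) = k at *
  generalize #(spec K f) = θ at *
  have hb := boundary_of_competitors (p := p) (q := q) (c := p + 1 - t) (s := s) (t := t)
    (r := q + 1 - s) (k := k) (θ := θ) hpq.le (by omega) hT1 (by omega) hS1
    (by omega) (by omega) hk hθ e₁ e₂ e₃ e₄
  have hb' := boundary_of_competitors (p := p) (q := q) (c := s') (s := q + 1 - t')
    (t := p + 1 - s') (r := t') (k := k) (θ := θ) hpq.le (by omega) (by omega) (by omega) (by omega)
    (by omega) (by omega) (by rwa [mul_comm]) (by rwa [mul_comm]) e₁ e₂ e₃ e₄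
  by_cases hsq : s = q
  · subst hsq
    have h1 : θ ≤ t := e₄ (p + 1 - t) t (by omega) hT1 (by omega) hk
    right
    have hs'p : s' = p := by
      -- Otherwise `t' = q`, while `t' ≤ θ ≤ t ≤ p < q`.
      by_contra hne
      have h2 : t' = s := by omega
      omega
    subst hs'p
    have h2 : θ ≤ t' := e₂ (s + 1 - t') t' (by omega) (by omega) (by omega) hk'
    refine ⟨by omega, by omega, hfst h1, hsnd h2, ?_⟩
    by_contra! h3
    have := e₄ (s' + 2 - t) (t - 1) (by omega) (by omega) (by omega)
      (by rwa [show θ = t by omega] at h3)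
    omega
  · left
    have htp : t = p := by omega
    subst htp
    have h1 : k ≤ s := by
      by_contra hne
      have h2 := e₃ (s + 1) (q - s) (by omega) (by omega) (by omega) (by omega)
      have h3 : t * (q - s) < t * (q + 1 - s) := Nat.mul_lt_mul_of_pos_left (by omega) (by omega)
      omega
    refine ⟨hsndsupp h1, hsnd ?_⟩
    by_cases hs'p : s' = t
    · subst hs'p
      exact e₂ (q + 1 - t') t' (by omega) (by omega) (by omega) hk'
    -- Here both splittings compute `θ`, as `q(p + 1 - s')` and as `p(q + 1 - s)`. Coprimality makes
    -- `p` divide `p + 1 - s'`, which lies strictly between `0` and `p`.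
    · exfalso
      have ht'q : t' = q := by omega
      subst ht'q
      have h2 := e₁ s' (t + 1 - s') (by omega) (by omega) (by omega) hSk'
      have h3 := e₃ s (t' + 1 - s) (by omega) (by omega) (by omega) hSk
      have h4 : t' * (t + 1 - s') = t * (t' + 1 - s) := by omega
      have h5 : t ∣ t + 1 - s' := hcop.dvd_of_dvd_mul_left (h4 ▸ Dvd.intro _ rfl)
      have h6 := Nat.le_of_dvd (by omega) h5
      omega

end Classification

/-! ### Fourier matrices of cyclic groups and coordinates on the dual group -/

section ZModKernels

/-- The Fourier matrix of `ZMod n`. -/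
noncomputable def zmodKernel (n : ℕ) [NeZero n] : ZMod n → ZMod n → ℂ :=
  fun ξ x => ZMod.stdAddChar (ξ * x)

theorem stdAddChar_pow_eq_one {n : ℕ} [NeZero n] (a : ZMod n) :
    (ZMod.stdAddChar a : ℂ) ^ n = 1 := by
  rw [← AddChar.map_nsmul_eq_pow]
  simp

theorem stdAddChar_mul_eq_pow {n : ℕ} [NeZero n] (a b : ZMod n) :
    (ZMod.stdAddChar (a * b) : ℂ) = ZMod.stdAddChar a ^ b.val := by
  rw [← AddChar.map_nsmul_eq_pow, nsmul_eq_mul, ZMod.natCast_zmod_val, mul_comm]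

theorem sum_stdAddChar_mul {n : ℕ} [NeZero n] (a : ZMod n) :
    ∑ m : ZMod n, (ZMod.stdAddChar (m * a) : ℂ) = if a = 0 then (n : ℂ) else 0 := by
  have := AddChar.sum_mulShift a (ZMod.isPrimitive_stdAddChar n)
  simpa [ZMod.card] using this

/-- Chebotarev's theorem on the minors of the Fourier matrix of a group of prime order. -/
theorem isChebotarev_zmodKernel (p : ℕ) [hp : Fact p.Prime] : IsChebotarev (zmodKernel p) := by
  intro g hg
  have h1 := card_roots_lt_card_support (p := p) g hg (fun x => x.val) (supp g)
    (by simp) (fun x _ y _ h => by simpa using h) 1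
    ((spec (zmodKernel p) g)ᶜ.image ZMod.stdAddChar) ?_ ?_
  · rw [card_image_of_injective _ ZMod.injective_stdAddChar, card_compl] at h1
    omega
  · intro z hz
    obtain ⟨ξ, -, rfl⟩ := mem_image.1 hz
    rw [pow_one]
    exact stdAddChar_pow_eq_one ξ
  · intro z hz
    obtain ⟨ξ, hξ, rfl⟩ := mem_image.1 hz
    simp only [mem_compl, mem_spec, not_not, zmodKernel, stdAddChar_mul_eq_pow] at hξ
    rw [← hξ]
    exact sum_congr rfl fun x _ => mul_comm _ _

variable {G : Type*} [AddCommGroup G] [Fintype G] [DecidableEq G] [DecidableEq (AddChar G ℂ)]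

/-- An injective family of `|G|` characters parametrizes all characters of `G`. -/
theorem exists_charEquiv {M : Type*} [Fintype M] (ψ : M → AddChar G ℂ) (hψ : Function.Injective ψ)
    (hM : Fintype.card M = Fintype.card G) : ∃ D : M ≃ AddChar G ℂ, ∀ m, D m = ψ m :=
  ⟨Equiv.ofBijective ψ ((Fintype.bijective_iff_injective_and_card ψ).2
    ⟨hψ, by rw [AddChar.card_eq, hM]⟩), fun _ => rfl⟩

theorem exists_charEquiv_zmod {n : ℕ} [NeZero n] (φ : G ≃+ ZMod n) :
    ∃ D : ZMod n ≃ AddChar G ℂ, ∀ m x, D m (φ.symm x) = zmodKernel n m x := by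
  let ψ : ZMod n → AddChar G ℂ := fun m =>
    (AddChar.mulShift (ZMod.stdAddChar (N := n)) m).compAddMonoidHom φ.toAddMonoidHom
  have hψ : Function.Injective ψ := by
    intro m m' h
    have := DFunLike.congr_fun h (φ.symm 1)
    simp only [ψ, AddChar.compAddMonoidHom_apply, AddChar.mulShift_apply] at this
    simpa using ZMod.injective_stdAddChar this
  obtain ⟨D, hD⟩ := exists_charEquiv ψ hψ (Fintype.card_congr φ.symm.toEquiv)
  exact ⟨D, fun m x => by simp [hD, ψ, zmodKernel]⟩

theorem exists_charEquiv_prod {p q : ℕ} [NeZero p] [NeZero q] (φ : G ≃+ ZMod p × ZMod q) :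
    ∃ D : ZMod p × ZMod q ≃ AddChar G ℂ, ∀ ζ z, D ζ (φ.symm z) =
      splitKernel (zmodKernel p) (fun _ _ => 1) (zmodKernel q) ζ z := by
  let ψ : ZMod p × ZMod q → AddChar G ℂ := fun ζ =>
    (AddChar.mulShift (ZMod.stdAddChar (N := p)) ζ.1).compAddMonoidHom
      ((AddMonoidHom.fst _ _).comp φ.toAddMonoidHom) *
    (AddChar.mulShift (ZMod.stdAddChar (N := q)) ζ.2).compAddMonoidHom
      ((AddMonoidHom.snd _ _).comp φ.toAddMonoidHom)
  have hψ_apply : ∀ ζ z, ψ ζ (φ.symm z) =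
      splitKernel (zmodKernel p) (fun _ _ => 1) (zmodKernel q) ζ z := by
    intro ζ z
    simp [ψ, zmodKernel, splitKernel]
  have hψ : Function.Injective ψ := by
    intro m m' h
    have h1 := DFunLike.congr_fun h (φ.symm (1, 0))
    have h2 := DFunLike.congr_fun h (φ.symm (0, 1))
    simp only [hψ_apply, splitKernel, zmodKernel, mul_one, mul_zero, one_mul,
      AddChar.map_zero_eq_one] at h1 h2
    exact Prod.ext (ZMod.injective_stdAddChar h1) (ZMod.injective_stdAddChar h2)
  obtain ⟨D, hD⟩ := exists_charEquiv ψ hψ (Fintype.card_congr φ.symm.toEquiv)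
  exact ⟨D, fun m x => by rw [hD, hψ_apply]⟩

end ZModKernels

/-! ### The group `ZMod (p ^ 2)` -/

section PrimeSquare

variable (p : ℕ) [hp : Fact p.Prime]

theorem stdAddChar_natCast_mul_self (a : ℕ) :
    (ZMod.stdAddChar ((p * a : ℕ) : ZMod (p ^ 2)) : ℂ) =
      ZMod.stdAddChar (a : ZMod p) := by
  have h1 := ZMod.stdAddChar_coe (N := p ^ 2) ((p * a : ℕ) : ℤ)
  have h2 := ZMod.stdAddChar_coe (N := p) (a : ℤ)
  simp only [Int.cast_natCast] at h1 h2
  rw [h1, h2]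
  congr 1
  have : (p : ℂ) ≠ 0 := Nat.cast_ne_zero.2 hp.out.ne_zero
  push_cast
  field_simp

/-- The coordinates `x = z₂ + p z₁` of an element of `ZMod (p ^ 2)`. -/
def digits (z : ZMod p × ZMod p) : ℕ := z.2.val + p * z.1.val

theorem digits_lt (z : ZMod p × ZMod p) : digits p z < p ^ 2 := by
  have h1 := ZMod.val_lt z.1
  have h2 := ZMod.val_lt z.2
  unfold digits
  nlinarith

theorem digits_cast (z : ZMod p × ZMod p) : (digits p z : ZMod p) = z.2 := by
  simp [digits]

theorem digits_injective : Function.Injective (digits p) := by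
  intro z z' h
  have h2 : z.2 = z'.2 := by rw [← digits_cast, ← digits_cast, h]
  have h1 : p * z.1.val = p * z'.1.val := by
    unfold digits at h
    rw [h2] at h
    omega
  exact Prod.ext (ZMod.val_injective p (Nat.eq_of_mul_eq_mul_left hp.out.pos h1)) h2

/-- The coordinates of elements of `ZMod (p ^ 2)`. -/
noncomputable def digitsEquiv : ZMod p × ZMod p ≃ ZMod (p ^ 2) :=
  Equiv.ofBijective (fun z => (digits p z : ZMod (p ^ 2))) <| by
    rw [Fintype.bijective_iff_injective_and_card]
    refine ⟨fun z z' h => digits_injective p ?_, by simp [ZMod.card, sq]⟩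
    have := (ZMod.natCast_eq_natCast_iff' _ _ _).1 h
    rwa [Nat.mod_eq_of_lt (digits_lt p z), Nat.mod_eq_of_lt (digits_lt p z')] at this

theorem digitsEquiv_apply (z : ZMod p × ZMod p) : digitsEquiv p z = (digits p z : ZMod (p ^ 2)) :=
  rfl

/-- The twist in the Fourier matrix of `ZMod (p ^ 2)`. -/
noncomputable def sqTwist : ZMod p → ZMod p → ℂ :=
  fun ξ y => ZMod.stdAddChar ((ξ.val * y.val : ℕ) : ZMod (p ^ 2))

theorem sqTwist_ne_zero (ξ y : ZMod p) : sqTwist p ξ y ≠ 0 := addChar_ne_zero _ _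

/-- Modulo `p ^ 2`, `(ζ₁ + pζ₂)(z₂ + pz₁) = pζ₁z₁ + ζ₁z₂ + pζ₂z₂`; the middle term is the twist. The
swap makes the first dual coordinate the residue modulo `p`. -/
theorem zmodKernel_digits (ζ z : ZMod p × ZMod p) :
    zmodKernel (p ^ 2) (digitsEquiv p ζ.swap) (digitsEquiv p z) =
      splitKernel (zmodKernel p) (sqTwist p) (zmodKernel p) ζ z := by
  have h0 : ((p : ZMod (p ^ 2)) * p) = 0 := by
    have : ((p ^ 2 : ℕ) : ZMod (p ^ 2)) = 0 := ZMod.natCast_self _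
    rw [← this]; push_cast; ring
  have h : digitsEquiv p ζ.swap * digitsEquiv p z =
      ((p * (ζ.1.val * z.1.val) : ℕ) : ZMod (p ^ 2)) + ((ζ.1.val * z.2.val : ℕ) : ZMod (p ^ 2)) +
        ((p * (ζ.2.val * z.2.val) : ℕ) : ZMod (p ^ 2)) := by
    simp only [digitsEquiv_apply, digits, Prod.fst_swap, Prod.snd_swap]
    push_cast
    linear_combination (ζ.2.val * z.1.val : ZMod (p ^ 2)) * h0
  rw [zmodKernel, h, AddChar.map_add_eq_mul, AddChar.map_add_eq_mul, stdAddChar_natCast_mul_self,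
    stdAddChar_natCast_mul_self]
  simp [splitKernel, zmodKernel, sqTwist]

theorem hasRankOnePartition_zmodKernel_sq {f : ZMod (p ^ 2) → ℂ}
    (hf : IsExtremal (zmodKernel (p ^ 2)) f) : HasRankOnePartition (zmodKernel (p ^ 2)) f := by
  set K := splitKernel (zmodKernel p) (sqTwist p) (zmodKernel p) with hK
  set D : ZMod p × ZMod p ≃ ZMod (p ^ 2) := (Equiv.prodComm _ _).trans (digitsEquiv p) with hD
  have hKD : (fun ζ z => zmodKernel (p ^ 2) (D ζ) (digitsEquiv p z)) = K := by
    funext ζ z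
    exact zmodKernel_digits p ζ z
  refine HasRankOnePartition.of_comp_equiv D (digitsEquiv p) ?_
  have hext := hf.comp_equiv D (digitsEquiv p)
  set g : ZMod p × ZMod p → ℂ := f ∘ digitsEquiv p with hg
  have hKz : ∀ ζ z, K ζ z = ZMod.stdAddChar (D ζ * digitsEquiv p z) := fun ζ z => by
    rw [← hKD]; rfl
  rw [hKD] at hext ⊢
  have hcard : Fintype.card (ZMod p) = p := ZMod.card p
  have h2 := hp.out.two_le
  rcases hext.cases_of_card_eq (isChebotarev_zmodKernel p) (isChebotarev_zmodKernel p)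
    (sqTwist_ne_zero p) hcard hcard hcard hcard with h | ⟨hk2, hkp, hinj, hspec⟩ |
    ⟨hθ2, hθp, hkp, hinj, hlt⟩
  · exact h
  -- The transform of `g` has `p(k - 1)` zeros, where `k = #(supp g) ≥ 2`, but the exponents are
  -- distinct modulo `p`, which allows fewer than `k`.
  · exfalso
    rw [← hK] at hspec
    have h1 := card_roots_lt_card_support (p := p) g hext.1 (digits p) (supp g) (by simp) ?_ 2
      ((spec K g)ᶜ.image fun ζ => ZMod.stdAddChar (D ζ)) ?_ ?_
    · rw [card_image_of_injective _ (show Function.Injective fun ζ => (ZMod.stdAddChar (D ζ) : ℂ) from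
        ZMod.injective_stdAddChar.comp D.injective), card_compl,
        hspec, Fintype.card_prod, hcard] at h1
      obtain ⟨k, hk⟩ : ∃ k, #(supp g) = k + 2 := ⟨_, (Nat.sub_add_cancel hk2).symm⟩
      rw [hk] at h1 hkp
      obtain ⟨d, hd⟩ : ∃ d, p = k + 2 + d := ⟨_, (Nat.add_sub_cancel' hkp.le).symm⟩
      have h3 : p + 1 - (k + 2) = d + 1 := by omega
      rw [h3, ← Nat.mul_sub, show p - (d + 1) = k + 1 by omega] at h1
      nlinarith
    · intro z hz z' hz' h
      simp only [digits_cast] at h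
      exact hinj hz hz' h
    · intro z hz
      obtain ⟨ζ, -, rfl⟩ := mem_image.1 hz
      exact stdAddChar_pow_eq_one _
    · intro z hz
      obtain ⟨ζ, hζ, rfl⟩ := mem_image.1 hz
      rw [mem_compl, mem_spec, not_not] at hζ
      rw [← hζ]
      refine sum_congr rfl fun z _ => ?_
      rw [hKz, digitsEquiv_apply, ← AddChar.map_nsmul_eq_pow, nsmul_eq_mul, mul_comm,
        mul_comm (D ζ)]
  · rw [← hK] at hθ2 hθp hinj hlt
    -- Fourier inversion presents `g` itself as a sparse polynomial in a root of unity, with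
    -- exponents in the spectrum.
    have hinv : ∀ z, ∑ ζ, (∑ z', K ζ z' * g z') * ZMod.stdAddChar (-digitsEquiv p z) ^
        digits p ζ.swap = (p : ℂ) ^ 2 * g z := by
      intro z
      have h3 : ∀ ζ, (∑ z', K ζ z' * g z') * ZMod.stdAddChar (-digitsEquiv p z) ^
          digits p ζ.swap =
          ∑ z', ZMod.stdAddChar (D ζ * (digitsEquiv p z' - digitsEquiv p z)) * g z' := by
        intro ζ
        rw [sum_mul]
        refine sum_congr rfl fun z' _ => ?_
        rw [← AddChar.map_nsmul_eq_pow, nsmul_eq_mul, hKz, mul_sub, sub_eq_add_neg,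
          AddChar.map_add_eq_mul, ← mul_neg]
        have : D ζ = (digits p ζ.swap : ZMod (p ^ 2)) := rfl
        rw [this]
        ring
      simp_rw [h3]
      rw [sum_comm]
      simp_rw [← sum_mul]
      have h4 : ∀ a : ZMod (p ^ 2), ∑ ζ, (ZMod.stdAddChar (D ζ * a) : ℂ) =
          if a = 0 then ((p ^ 2 : ℕ) : ℂ) else 0 := by
        intro a
        rw [← sum_stdAddChar_mul, ← Equiv.sum_comp D]
      simp_rw [h4, sub_eq_zero, (digitsEquiv p).injective.eq_iff]
      simp
    have h1 := card_roots_lt_card_support (p := p) (fun ζ => ∑ z', K ζ z' * g z') ?_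
      (fun ζ => digits p ζ.swap) (spec K g) (by simp) ?_ 2
      ((supp g)ᶜ.image fun z => ZMod.stdAddChar (-digitsEquiv p z)) ?_ ?_
    · rw [card_image_of_injective _ (show Function.Injective fun z =>
        (ZMod.stdAddChar (-digitsEquiv p z) : ℂ) from ZMod.injective_stdAddChar.comp
          (neg_injective.comp (digitsEquiv p).injective)), card_compl, Fintype.card_prod,
        hcard] at h1
      refine hasRankOnePartition_of_card_add_card hext.1 ?_
      rw [Fintype.card_prod, hcard]
      -- With `θ` the size of the spectrum, `g` has more than `p(θ - 2)` and fewer than `θ` zeros,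
      -- which leaves only `θ = 2` and exactly one zero.
      have h3 : #(spec K g) = 2 := by
        by_contra hne
        obtain ⟨t, ht⟩ : ∃ t, #(spec K g) = t + 3 := ⟨#(spec K g) - 3, by omega⟩
        rw [ht] at h1 hlt hθp
        obtain ⟨d, hd⟩ : ∃ d, p = t + 3 + d := ⟨_, (Nat.add_sub_cancel' hθp).symm⟩
        rw [show p + 2 - (t + 3) = d + 2 by omega] at hlt
        have h5 : p * p < t + 3 + #(supp g) := by omega
        nlinarith
      rw [h3] at hlt h1 ⊢
      simp only [Nat.add_sub_cancel] at hlt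
      omega
    · intro h0
      have : g = 0 := by
        funext z
        have h3 := hinv z
        have h4 : (p : ℂ) ^ 2 ≠ 0 := pow_ne_zero _ (Nat.cast_ne_zero.2 hp.out.ne_zero)
        have h5 : ∀ ζ, ∑ z', K ζ z' * g z' = 0 := fun ζ => congrFun h0 ζ
        simp only [h5, zero_mul, sum_const_zero] at h3
        simpa using (mul_eq_zero.1 h3.symm).resolve_left h4
      exact hext.1 this
    · intro ζ hζ ζ' hζ' h
      simp only [digits_cast, Prod.snd_swap] at h
      exact hinj hζ hζ' h
    · intro z hz
      obtain ⟨ζ, -, rfl⟩ := mem_image.1 hz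
      exact stdAddChar_pow_eq_one _
    · intro w hw
      obtain ⟨z, hz, rfl⟩ := mem_image.1 hw
      rw [mem_compl, mem_supp, not_not] at hz
      rw [hinv, hz, mul_zero]

end PrimeSquare

/-! ### Transfer to `G`, and the plane `ZMod p × ZMod p` -/

section GroupCases

variable {G : Type*} [AddCommGroup G] [Fintype G] [DecidableEq G] [DecidableEq (AddChar G ℂ)]
  {f : G → ℂ}

theorem hasRankOnePartition_of_addEquiv_zmod_sq {p : ℕ} [Fact p.Prime] (φ : G ≃+ ZMod (p ^ 2))
    (hf : IsExtremal (pairing G) f) : HasRankOnePartition (pairing G) f := by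
  obtain ⟨D, hD⟩ := exists_charEquiv_zmod φ
  have hK : (fun m x => pairing G (D m) (φ.symm.toEquiv x)) = zmodKernel (p ^ 2) := by
    funext m x
    exact hD m x
  refine HasRankOnePartition.of_comp_equiv D φ.symm.toEquiv ?_
  have := hf.comp_equiv D φ.symm.toEquiv
  rw [hK] at this ⊢
  exact hasRankOnePartition_zmodKernel_sq p this

/-- A nonzero vector of the plane over a prime field can be moved to the first axis. -/
theorem exists_addEquiv_snd_eq_zero {p : ℕ} [Fact p.Prime] (v : ZMod p × ZMod p) (hv : v ≠ 0) :
    ∃ α : (ZMod p × ZMod p) ≃+ ZMod p × ZMod p, (α v).2 = 0 ∧ (α v).1 ≠ 0 := by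
  obtain ⟨a, b⟩ := v
  by_cases ha : a = 0
  · refine ⟨AddEquiv.prodComm, by simpa using ha, ?_⟩
    rintro rfl
    exact hv (by simp [ha])
  · refine ⟨AddEquiv.mk ⟨fun z => (z.1, z.2 - b / a * z.1), fun z => (z.1, z.2 + b / a * z.1),
      fun z => by simp, fun z => by simp⟩ fun z z' => Prod.ext rfl ?_, ?_, ?_⟩
    · simp only [Prod.snd_add, Prod.fst_add]
      ring
    · simp [ha]
    · simpa using ha

/-- Characters in the same dual coset are recognized by equal values at a nonzero point of the first
axis. This form mentions no dual coordinates, so `φ` can be varied. -/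
theorem cases_of_addEquiv_prod_self {p : ℕ} [Fact p.Prime] (φ : G ≃+ ZMod p × ZMod p)
    (hf : IsExtremal (pairing G) f) :
    HasRankOnePartition (pairing G) f ∨
    (2 ≤ #(supp f) ∧ #(supp f) < p ∧
      ∀ x y, x ∈ supp f → y ∈ supp f → (φ x).2 = (φ y).2 → x = y) ∨
    (2 ≤ #(spec (pairing G) f) ∧ p ≤ #(supp f) ∧
      ∀ χ ψ a, χ ∈ spec (pairing G) f → ψ ∈ spec (pairing G) f → (φ a).2 = 0 → (φ a).1 ≠ 0 →
        χ a = ψ a → χ = ψ) := by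
  obtain ⟨D, hD⟩ := exists_charEquiv_prod φ
  set K := splitKernel (zmodKernel p) (fun _ _ => 1) (zmodKernel p) with hK
  have hKD : (fun m x => pairing G (D m) (φ.symm.toEquiv x)) = K := by
    funext m x
    exact hD m x
  have hext := hf.comp_equiv D φ.symm.toEquiv
  have hsp := spec_comp_equiv D φ.symm.toEquiv (pairing G) f
  have hsu := supp_comp_equiv φ.symm.toEquiv f
  rw [hKD] at hext hsp
  have hcard : Fintype.card (ZMod p) = p := ZMod.card p
  rcases hext.cases_of_card_eq (isChebotarev_zmodKernel p) (isChebotarev_zmodKernel p)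
    (fun _ _ => one_ne_zero) hcard hcard hcard hcard with h | ⟨hk2, hkp, hinj, -⟩ |
    ⟨hθ2, -, hkp, hinj, -⟩
  · refine Or.inl (HasRankOnePartition.of_comp_equiv D φ.symm.toEquiv ?_)
    rwa [hKD]
  · right; left
    rw [card_supp_comp_equiv] at hk2 hkp
    refine ⟨hk2, hkp, fun x y hx hy hxy => φ.injective (hinj ?_ ?_ hxy)⟩
    · simpa using hx
    · simpa using hy
  · right; right
    rw [← hK, ← hKD, card_spec_comp_equiv] at hθ2
    rw [card_supp_comp_equiv] at hkp
    refine ⟨hθ2, hkp, fun χ ψ a hχ hψ ha2 ha1 h => ?_⟩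
    rw [← hsp] at hχ hψ
    obtain ⟨ζ, hζ, rfl⟩ := mem_map.1 hχ
    obtain ⟨ζ', hζ', rfl⟩ := mem_map.1 hψ
    congr 1
    refine hinj hζ hζ' ?_
    have h1 := hD ζ (φ a)
    have h2 := hD ζ' (φ a)
    rw [AddEquiv.symm_apply_apply] at h1 h2
    have h3 := (h1.symm.trans h).trans h2
    simp only [hK, splitKernel, zmodKernel, ha2, mul_zero, AddChar.map_zero_eq_one, mul_one] at h3
    exact mul_right_cancel₀ ha1 (ZMod.injective_stdAddChar h3)

/-- The exceptional cases would have to hold in every coordinate system. Coordinates that put two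
points of the support, or two characters of the spectrum, in one coset refute them; `#(supp f)`
against `p` tells the two cases apart. -/
theorem hasRankOnePartition_of_addEquiv_prod_self {p : ℕ} [Fact p.Prime]
    (φ : G ≃+ ZMod p × ZMod p) (hf : IsExtremal (pairing G) f) :
    HasRankOnePartition (pairing G) f := by
  rcases cases_of_addEquiv_prod_self φ hf with h | ⟨hk2, hkp, -⟩ | ⟨hθ2, hkp, -⟩
  · exact h
  · obtain ⟨x, hx, y, hy, hxy⟩ := one_lt_card.1 hk2
    obtain ⟨α, hα, -⟩ := exists_addEquiv_snd_eq_zero (φ (x - y)) (by simpa [sub_eq_zero] using hxy)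
    rcases cases_of_addEquiv_prod_self (φ.trans α) hf with h | ⟨-, -, h⟩ | ⟨-, h, -⟩
    · exact h
    · refine absurd (h x y hx hy ?_) hxy
      simpa [sub_eq_zero] using hα
    · omega
  · obtain ⟨χ, hχ, ψ, hψ, hne⟩ := one_lt_card.1 hθ2
    obtain ⟨a, ha0, ha⟩ : ∃ a : G, a ≠ 0 ∧ χ a = ψ a := by
      obtain ⟨D, hD⟩ := exists_charEquiv_prod φ
      obtain ⟨ζ, rfl⟩ := D.surjective χ
      obtain ⟨ζ', rfl⟩ := D.surjective ψ
      -- This point is orthogonal to `ζ - ζ'`, so both characters agree on it.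
      refine ⟨φ.symm (ζ.2 - ζ'.2, ζ'.1 - ζ.1), fun h0 => hne ?_, ?_⟩
      · have h1 : ((ζ.2 - ζ'.2, ζ'.1 - ζ.1) : ZMod p × ZMod p) = 0 := by simpa using h0
        simp only [Prod.mk_eq_zero, sub_eq_zero] at h1
        rw [show ζ = ζ' from Prod.ext h1.2.symm h1.1]
      · rw [hD, hD]
        simp only [splitKernel, zmodKernel, mul_one, ← AddChar.map_add_eq_mul]
        congr 1
        ring
    obtain ⟨α, hα2, hα1⟩ := exists_addEquiv_snd_eq_zero (φ a) (by simpa using ha0)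
    rcases cases_of_addEquiv_prod_self (φ.trans α) hf with h | ⟨-, h, -⟩ | ⟨-, -, h⟩
    · exact h
    · omega
    · exact absurd (h χ ψ a hχ hψ hα2 hα1 ha) hne

end GroupCases

/-! ### Characters of `ZMod q` in residue characteristic `p` -/

section ReducedCharacters

variable (V : ValuationSubring ℂ)

/-- The standard additive character of `ZMod n` with values in a valuation ring. -/
noncomputable def integralChar (n : ℕ) [NeZero n] : AddChar (ZMod n) V where
  toFun a := ⟨ZMod.stdAddChar a,
    mem_valuationSubring_of_pow_eq_one V (NeZero.ne n) (stdAddChar_pow_eq_one a)⟩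
  map_zero_eq_one' := by ext; simp
  map_add_eq_mul' a b := by ext; simp [AddChar.map_add_eq_mul]

theorem coe_integralChar (n : ℕ) [NeZero n] (a : ZMod n) :
    (integralChar V n a : ℂ) = ZMod.stdAddChar a := rfl

/-- The reduction of the standard additive character of `ZMod n`. -/
noncomputable def residueChar (n : ℕ) [NeZero n] : AddChar (ZMod n) (IsLocalRing.ResidueField V) :=
  (IsLocalRing.residue V).toMonoidHom.compAddChar (integralChar V n)

theorem residueChar_apply (n : ℕ) [NeZero n] (a : ZMod n) :
    residueChar V n a = IsLocalRing.residue V (integralChar V n a) := rfl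

variable {V} {p q : ℕ} [hp : Fact p.Prime] [hq : Fact q.Prime]
  [CharP (IsLocalRing.ResidueField V) p]

theorem residueChar_self (a : ZMod p) : residueChar V p a = 1 := by
  rw [residueChar_apply]
  refine residue_eq_one_of_pow_eq_one (p := p) (r := 1) ?_
  ext
  simpa [coe_integralChar] using stdAddChar_pow_eq_one a

theorem natCast_residueField_ne_zero (hpq : p ≠ q) :
    ((q : ℕ) : IsLocalRing.ResidueField V) ≠ 0 := by
  rw [Ne, CharP.cast_eq_zero_iff _ p]
  exact fun h => hpq ((Nat.prime_dvd_prime_iff_eq hp.out hq.out).1 h)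

/-- The values of the character sum to zero; were the reduction trivial, this would say `q = 0` in
the residue field. -/
theorem isPrimitive_residueChar (hpq : p ≠ q) : (residueChar V q).IsPrimitive := by
  refine AddChar.IsPrimitive.of_ne_one fun h => natCast_residueField_ne_zero (V := V) hpq ?_
  have h1 : ∑ a : ZMod q, integralChar V q a = 0 := by
    ext
    have := sum_stdAddChar_mul (n := q) 1
    simp only [mul_one, one_ne_zero, if_false] at this
    simpa [coe_integralChar] using this
  have h2 := congrArg (IsLocalRing.residue V) h1
  rw [map_sum, map_zero] at h2
  simp only [← residueChar_apply, h, AddChar.one_apply] at h2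
  simpa [ZMod.card] using h2

theorem residueChar_injective (hpq : p ≠ q) : Function.Injective (residueChar V q) := by
  intro a b h
  by_contra hab
  refine isPrimitive_residueChar (V := V) hpq (sub_ne_zero.2 hab) ?_
  have h0 : residueChar V q (a - b) = 1 := by
    have h1 := (residueChar V q).map_add_eq_mul (a - b) b
    have h2 := (residueChar V q).map_add_eq_mul b (-b)
    rw [sub_add_cancel, h] at h1
    rw [add_neg_cancel, AddChar.map_zero_eq_one] at h2
    have h3 : residueChar V q b ≠ 0 := left_ne_zero_of_mul (h2 ▸ one_ne_zero)
    exact (mul_right_cancel₀ h3 (by rw [one_mul]; exact h1)).symm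
  ext x
  have : (a - b) * x = x.val • (a - b) := by
    rw [nsmul_eq_mul, ZMod.natCast_zmod_val, mul_comm]
  rw [AddChar.mulShift_apply, this, AddChar.map_nsmul_eq_pow, h0, one_pow, AddChar.one_apply]

/-- Fourier inversion on `ZMod q` survives the reduction because `q` stays invertible. -/
theorem eq_zero_of_sum_residueChar_mul_eq_zero (hpq : p ≠ q)
    (h : ZMod q → IsLocalRing.ResidueField V)
    (h0 : ∀ η, ∑ y, residueChar V q (η * y) * h y = 0) : h = 0 := by
  funext y₀
  have h1 : ∑ η, residueChar V q (-(η * y₀)) * ∑ y, residueChar V q (η * y) * h y =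
      (q : IsLocalRing.ResidueField V) * h y₀ := by
    simp_rw [mul_sum, ← mul_assoc, ← AddChar.map_add_eq_mul]
    rw [sum_comm]
    have h2 : ∀ η y : ZMod q, -(η * y₀) + η * y = η * (y - y₀) := fun η y => by ring
    simp_rw [h2, ← sum_mul, AddChar.sum_mulShift _ (isPrimitive_residueChar (V := V) hpq),
      sub_eq_zero]
    simp [ZMod.card]
  simp only [h0, mul_zero, sum_const_zero] at h1
  simpa using (mul_eq_zero.1 h1.symm).resolve_left (natCast_residueField_ne_zero hpq)

end ReducedCharacters

/-! ### The group `ZMod p × ZMod q` with `p ≠ q` -/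

section Rectangle

variable {p q : ℕ} [hp : Fact p.Prime] [hq : Fact q.Prime]

/-- The Fourier matrix of `ZMod p × ZMod q`. -/
noncomputable def prodKernel (p q : ℕ) [NeZero p] [NeZero q] :
    ZMod p × ZMod q → ZMod p × ZMod q → ℂ :=
  splitKernel (zmodKernel p) (fun _ _ => 1) (zmodKernel q)

theorem prodKernel_apply (ζ z : ZMod p × ZMod q) : prodKernel p q ζ z =
    ZMod.stdAddChar (ζ.1 * z.1) * ZMod.stdAddChar (ζ.2 * z.2) := by
  simp [prodKernel, splitKernel, zmodKernel]

theorem prodKernel_inversion (f : ZMod p × ZMod q → ℂ) (z : ZMod p × ZMod q) :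
    ∑ ζ, (∑ z', prodKernel p q ζ z' * f z') * (ZMod.stdAddChar (-(ζ.2 * z.2)) *
      ZMod.stdAddChar (-(ζ.1 * z.1))) = ((p : ℂ) * q) * f z := by
  simp only [sum_mul]
  rw [sum_comm]
  have h1 : ∀ z' : ZMod p × ZMod q, ∑ ζ, prodKernel p q ζ z' * f z' *
      (ZMod.stdAddChar (-(ζ.2 * z.2)) * ZMod.stdAddChar (-(ζ.1 * z.1))) =
      (∑ ξ : ZMod p, ZMod.stdAddChar (ξ * (z'.1 - z.1))) *
        (∑ η : ZMod q, ZMod.stdAddChar (η * (z'.2 - z.2))) * f z' := by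
    intro z'
    rw [sum_mul_sum, ← Fintype.sum_prod_type', sum_mul]
    refine sum_congr rfl fun ζ _ => ?_
    rw [prodKernel_apply, mul_sub, mul_sub, sub_eq_add_neg, sub_eq_add_neg,
      AddChar.map_add_eq_mul, AddChar.map_add_eq_mul]
    ring
  simp_rw [h1, sum_stdAddChar_mul, sub_eq_zero]
  rw [Fintype.sum_eq_single z]
  · simp
  · intro z' hz'
    by_cases h2 : z'.1 = z.1
    · rw [if_neg (fun h3 => hz' (Prod.ext h2 h3))]; simp
    · rw [if_neg h2]; simp

/-- A nonzero function with one point at most on each `ZMod p`-coset cannot have a spectrum with the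
dual property for the other factor. -/
theorem eq_zero_of_injOn_snd (hpq : p ≠ q) {f : ZMod p × ZMod q → ℂ}
    (hsupp : Set.InjOn Prod.snd (supp f : Set (ZMod p × ZMod q)))
    (hspec : Set.InjOn Prod.snd (spec (prodKernel p q) f : Set (ZMod p × ZMod q))) : f = 0 := by
  by_contra hf
  obtain ⟨V, hV⟩ := exists_valuationSubring_charP p
  obtain ⟨c, hc, g, hg, ⟨x₀, y₀⟩, hi⟩ := exists_integral_scaling V hf
  -- At most one `ξ` over each `η` lies in the spectrum, and `0 ≠ 1` in `ZMod p`.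
  have hvan : ∀ η : ZMod q, ∃ ξ : ZMod p, ∑ z, prodKernel p q (ξ, η) z * f z = 0 := by
    intro η
    by_contra! h
    have := hspec (mem_coe.2 (mem_spec.2 (h 0))) (mem_coe.2 (mem_spec.2 (h 1))) rfl
    simp at this
  -- After reduction the choice of `ξ` no longer matters, so all column sums vanish. A column has at
  -- most one nonzero entry, hence each entry reduces to zero, against the scaling.
  have hh := eq_zero_of_sum_residueChar_mul_eq_zero (V := V) (p := p) hpq
    (fun y => ∑ x, IsLocalRing.residue V (g (x, y))) ?_
  · have h1 := congrFun hh y₀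
    simp only [Pi.zero_apply] at h1
    rw [Finset.sum_eq_single x₀] at h1
    · exact hi h1
    · intro x _ hx
      have : g (x, y₀) = 0 := by
        ext
        rw [hg]
        by_contra hne
        have hx0 : f (x, y₀) ≠ 0 := by
          intro h0; simp [h0] at hne
        have hx1 : f (x₀, y₀) ≠ 0 := by
          intro h0
          have : g (x₀, y₀) = 0 := by ext; simp [hg, h0]
          simp [this] at hi
        have := hsupp (mem_coe.2 (mem_supp.2 hx0)) (mem_coe.2 (mem_supp.2 hx1)) rfl
        exact hx (congrArg Prod.fst this)
      rw [this, map_zero]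
    · simp
  · intro η
    obtain ⟨ξ, hξ⟩ := hvan η
    have h1 : ∑ z : ZMod p × ZMod q, integralChar V p (ξ * z.1) * integralChar V q (η * z.2) * g z
        = 0 := by
      ext
      push_cast
      simp only [coe_integralChar, hg]
      simp only [prodKernel_apply] at hξ
      rw [← mul_zero c, ← hξ, mul_sum]
      exact sum_congr rfl fun z _ => by ring
    have h2 := congrArg (IsLocalRing.residue V) h1
    rw [map_sum, map_zero, Fintype.sum_prod_type_right] at h2
    rw [← h2]
    refine sum_congr rfl fun y _ => ?_
    rw [mul_sum]
    refine sum_congr rfl fun x _ => ?_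
    rw [map_mul (IsLocalRing.residue V), map_mul (IsLocalRing.residue V), ← residueChar_apply,
      ← residueChar_apply, residueChar_self (p := p), one_mul]

/-- Leading zeros in the rows of a regular matrix are few. -/
theorem sum_le_of_det_ne_zero {κ : Type*} [Field κ] {w : ℕ} (E : Matrix (Fin w) (Fin w) κ)
    (hE : E.det ≠ 0) (m : Fin w → ℕ) (hm : ∀ r (i : Fin w), (i : ℕ) < m r → E r i = 0) :
    2 * ∑ r, m r ≤ w * (w - 1) := by
  -- Some term of the Leibniz expansion is nonzero; then `m r ≤ σ r` for every row.
  obtain ⟨σ, hσ⟩ : ∃ σ : Equiv.Perm (Fin w), ∀ r, E r (σ r) ≠ 0 := by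
    by_contra! h
    apply hE
    rw [← Matrix.det_transpose, Matrix.det_apply]
    refine Finset.sum_eq_zero fun σ _ => ?_
    obtain ⟨r, hr⟩ := h σ
    rw [Finset.prod_eq_zero (mem_univ r) (by simpa using hr), smul_zero]
  have h1 : ∑ r, m r ≤ ∑ r, ((σ r : Fin w) : ℕ) := by
    refine Finset.sum_le_sum fun r _ => ?_
    by_contra! h
    exact hσ r (hm r _ h)
  rw [Equiv.sum_comp σ (fun r : Fin w => (r : ℕ)), Fin.sum_univ_eq_sum_range (fun i => i) w] at h1
  have := Finset.sum_range_id_mul_two w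
  omega

/-- The number of zeros of an exponential sum whose frequencies have distinct coordinates. -/
theorem two_mul_card_zeros_le (hpq : p ≠ q) {f : ZMod p × ZMod q → ℂ} (hf : f ≠ 0)
    (hfst : Set.InjOn Prod.fst (spec (prodKernel p q) f : Set (ZMod p × ZMod q)))
    (hsnd : Set.InjOn Prod.snd (spec (prodKernel p q) f : Set (ZMod p × ZMod q))) :
    2 * #(supp f)ᶜ ≤ q * (#(spec (prodKernel p q) f) - 1) := by
  classical
  set K := prodKernel p q with hK
  set l : ZMod p × ZMod q → ℂ := fun ζ => ∑ z, K ζ z * f z with hl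
  have hinv := fun z => prodKernel_inversion f z
  rw [← hK] at hinv
  change ∀ z : ZMod p × ZMod q, ∑ ζ, l ζ * (ZMod.stdAddChar (-(ζ.2 * z.2)) *
    ZMod.stdAddChar (-(ζ.1 * z.1))) = ((p : ℂ) * q) * f z at hinv
  have hpq0 : (p : ℂ) * q ≠ 0 :=
    mul_ne_zero (Nat.cast_ne_zero.2 hp.out.ne_zero) (Nat.cast_ne_zero.2 hq.out.ne_zero)
  have hl0 : l ≠ 0 := by
    intro h
    apply hf
    funext z
    have h1 := hinv z
    simp only [h, Pi.zero_apply, zero_mul, sum_const_zero] at h1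
    simpa using (mul_eq_zero.1 h1.symm).resolve_left hpq0
  obtain ⟨V, hV⟩ := exists_valuationSubring_charP p
  obtain ⟨c, hc, g, hg, ζ₀, hζ₀⟩ := exists_integral_scaling V hl0
  set J : Finset (ZMod p × ZMod q) := {ζ | IsLocalRing.residue V (g ζ) ≠ 0} with hJ
  have hJmem : ∀ ζ, ζ ∈ J ↔ IsLocalRing.residue V (g ζ) ≠ 0 := by simp [hJ]
  have hJspec : J ⊆ spec K f := by
    intro ζ hζ
    rw [hJmem] at hζ
    rw [mem_spec]
    intro h0
    have : g ζ = 0 := by ext; simp [hg, hl, h0]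
    simp [this] at hζ
  have hJpos : 0 < #J := card_pos.2 ⟨ζ₀, (hJmem _).2 hζ₀⟩
  let m : ZMod q → ℕ := fun y => #{x : ZMod p | f (x, y) = 0}
  -- On the coset of `y`, the function is a polynomial in a `p`-th root of unity with `m y` zeros,
  -- so its first `m y` moments vanish after reduction.
  have hvan : ∀ y i, i < m y → ∑ ζ ∈ J, IsLocalRing.residue V (g ζ) * residueChar V q (-(ζ.2 * y)) *
      (ζ.1.val : IsLocalRing.ResidueField V) ^ i = 0 := by
    intro y i hi
    have h1 := sum_residue_mul_pow_eq_zero (V := V) (p := p)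
      (fun ζ : ZMod p × ZMod q => g ζ * integralChar V q (-(ζ.2 * y))) (fun ζ => ζ.1.val) 1
      ((univ.filter fun x : ZMod p => f (x, y) = 0).image fun x => ZMod.stdAddChar (-x)) ?_ ?_ i ?_
    · rw [← h1]
      refine (sum_subset (subset_univ J) ?_).trans ?_
      · intro ζ _ hζ
        rw [hJmem, not_not] at hζ
        rw [hζ, zero_mul, zero_mul]
      · refine sum_congr rfl fun ζ _ => ?_
        rw [map_mul, residueChar_apply]
    · intro z hz
      obtain ⟨x, -, rfl⟩ := mem_image.1 hz
      rw [pow_one]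
      exact stdAddChar_pow_eq_one _
    · intro z hz
      obtain ⟨x, hx, rfl⟩ := mem_image.1 hz
      have hx0 : f (x, y) = 0 := by simpa using hx
      have h2 := hinv (x, y)
      rw [hx0, mul_zero] at h2
      rw [← mul_zero c, ← h2, mul_sum]
      refine sum_congr rfl fun ζ _ => ?_
      push_cast
      rw [hg, coe_integralChar, ← stdAddChar_mul_eq_pow]
      rw [show -x * ζ.1 = -(ζ.1 * x) by ring]
      ring
    · rwa [card_image_of_injective _ (show Function.Injective fun x : ZMod p =>
        (ZMod.stdAddChar (-x) : ℂ) from ZMod.injective_stdAddChar.comp neg_injective)]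
  -- The moments at `#J` consecutive values of `y` form Vandermonde × diagonal × Vandermonde. It is
  -- regular since both coordinates are injective on `J`, and row `r` starts with `m (y₀ + r)`
  -- zeros.
  have hwindow : ∀ y₀ : ZMod q, 2 * ∑ r : Fin #J, m (y₀ + (r : ℕ)) ≤ #J * (#J - 1) := by
    intro y₀
    let j : Fin #J → ZMod p × ZMod q := fun a => (J.equivFin.symm a).1
    have hjJ : ∀ a, j a ∈ J := fun a => (J.equivFin.symm a).2
    have hjinj : Function.Injective j := Subtype.val_injective.comp J.equivFin.symm.injective
    let A : Matrix (Fin #J) (Fin #J) (IsLocalRing.ResidueField V) :=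
      (Matrix.vandermonde fun a => residueChar V q (-(j a).2)).transpose
    let d : Fin #J → IsLocalRing.ResidueField V := fun a =>
      IsLocalRing.residue V (g (j a)) * residueChar V q (-((j a).2 * y₀))
    let B : Matrix (Fin #J) (Fin #J) (IsLocalRing.ResidueField V) :=
      Matrix.vandermonde fun a => ((j a).1.val : IsLocalRing.ResidueField V)
    have hcne : ∀ a, residueChar V q a ≠ 0 := by
      intro a h0
      have := (residueChar V q).map_add_eq_mul a (-a)
      simp [h0] at this
    refine sum_le_of_det_ne_zero (A * Matrix.diagonal d * B) ?_ _ ?_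
    · rw [Matrix.det_mul, Matrix.det_mul, Matrix.det_diagonal, Matrix.det_transpose]
      refine mul_ne_zero (mul_ne_zero ?_ ?_) ?_
      · rw [Matrix.det_vandermonde_ne_zero_iff]
        intro a b hab
        have h1 := residueChar_injective (V := V) hpq hab
        exact hjinj (hsnd (hJspec (hjJ a)) (hJspec (hjJ b)) (neg_injective h1))
      · exact prod_ne_zero_iff.2 fun a _ => mul_ne_zero ((hJmem _).1 (hjJ a)) (hcne _)
      · rw [Matrix.det_vandermonde_ne_zero_iff]
        intro a b hab
        refine hjinj (hfst (hJspec (hjJ a)) (hJspec (hjJ b)) ?_)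
        simp only at hab
        rw [CharP.natCast_eq_natCast (IsLocalRing.ResidueField V) p,
          ← ZMod.natCast_eq_natCast_iff] at hab
        simpa using hab
    · intro r i hi
      rw [← hvan _ _ hi, ← sum_coe_sort J, ← Equiv.sum_comp J.equivFin.symm]
      rw [Matrix.mul_apply]
      refine sum_congr rfl fun a _ => ?_
      rw [Matrix.mul_diagonal]
      simp only [A, B, d, Matrix.transpose_apply, Matrix.vandermonde_apply]
      rw [← AddChar.map_nsmul_eq_pow]
      have h1 : residueChar V q (-((j a).2 * (y₀ + (r : ℕ)))) =
          residueChar V q ((r : ℕ) • -(j a).2) * residueChar V q (-((j a).2 * y₀)) := by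
        rw [← AddChar.map_add_eq_mul, nsmul_eq_mul]
        congr 1
        ring
      change _ = IsLocalRing.residue V (g (j a)) * residueChar V q (-((j a).2 * (y₀ + (r : ℕ)))) *
        ((j a).1.val : IsLocalRing.ResidueField V) ^ (i : ℕ)
      rw [h1]
      ring
  have htotal : #(supp f)ᶜ = ∑ y, m y := by
    rw [card_eq_sum_card_fiberwise (f := Prod.snd) (t := univ) (by simp)]
    refine sum_congr rfl fun y _ => ?_
    refine (Finset.card_bij (fun x _ => (x, y)) ?_ ?_ ?_).symm
    · intro x hx; simpa using hx
    · intro x _ x' _ h; simpa using h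
    · rintro ⟨x, y'⟩ h
      simp only [mem_filter, mem_compl, mem_supp, not_not] at h
      obtain ⟨h1, rfl⟩ := h
      exact ⟨x, by simpa using h1, rfl⟩
  -- Summed over all `y₀`, the windows count each coset `#J` times.
  have hsum : #J * (2 * ∑ y, m y) ≤ #J * (q * (#J - 1)) := by
    have h1 : ∑ y₀ : ZMod q, 2 * ∑ r : Fin #J, m (y₀ + (r : ℕ)) ≤
        ∑ _y₀ : ZMod q, #J * (#J - 1) := sum_le_sum fun y _ => hwindow y
    rw [← mul_sum, sum_comm] at h1
    have h2 : ∀ r : Fin #J, ∑ y₀ : ZMod q, m (y₀ + (r : ℕ)) = ∑ y, m y := fun r =>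
      Equiv.sum_comp (Equiv.addRight ((r : ℕ) : ZMod q)) m
    simp only [h2, sum_const, card_univ, Fintype.card_fin, ZMod.card, smul_eq_mul] at h1
    calc #J * (2 * ∑ y, m y) = 2 * (#J * ∑ y, m y) := by ring
      _ ≤ q * (#J * (#J - 1)) := h1
      _ = #J * (q * (#J - 1)) := by ring
  have hfin := Nat.le_of_mul_le_mul_left hsum hJpos
  rw [htotal]
  exact hfin.trans (Nat.mul_le_mul_left _ (Nat.sub_le_sub_right (card_le_card hJspec) 1))

/-- A combination of two characters whose quotient is faithful has at most one zero. -/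
theorem card_zeros_le_one (hpq : p ≠ q) {f : ZMod p × ZMod q → ℂ}
    (hspec : #(spec (prodKernel p q) f) = 2)
    (hfst : Set.InjOn Prod.fst (spec (prodKernel p q) f : Set (ZMod p × ZMod q)))
    (hsnd : Set.InjOn Prod.snd (spec (prodKernel p q) f : Set (ZMod p × ZMod q))) :
    #(supp f)ᶜ ≤ 1 := by
  obtain ⟨ζ, ζ', hne, hs⟩ := card_eq_two.1 hspec
  have hζ : ζ ∈ spec (prodKernel p q) f := by simp [hs]
  have hζ' : ζ' ∈ spec (prodKernel p q) f := by simp [hs]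
  have h1 : ζ.1 - ζ'.1 ≠ 0 := fun h => hne (hfst hζ hζ' (sub_eq_zero.1 h))
  have h2 : ζ.2 - ζ'.2 ≠ 0 := fun h => hne (hsnd hζ hζ' (sub_eq_zero.1 h))
  rw [mem_spec] at hζ hζ'
  have hzero : ∀ z, f z = 0 → (∑ z', prodKernel p q ζ z' * f z') *
      (ZMod.stdAddChar (-(ζ.2 * z.2)) * ZMod.stdAddChar (-(ζ.1 * z.1))) =
      -((∑ z', prodKernel p q ζ' z' * f z') *
      (ZMod.stdAddChar (-(ζ'.2 * z.2)) * ZMod.stdAddChar (-(ζ'.1 * z.1)))) := by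
    intro z hz
    have h3 := prodKernel_inversion f z
    rw [hz, mul_zero, ← sum_subset (subset_univ (spec (prodKernel p q) f)), hs,
      sum_pair hne] at h3
    · exact eq_neg_of_add_eq_zero_left h3
    · intro ζ _ hζ
      rw [mem_spec, not_not] at hζ
      rw [hζ, zero_mul]
  rw [card_le_one]
  intro z hz w hw
  simp only [mem_compl, mem_supp, not_not] at hz hw
  have h3 : (ZMod.stdAddChar (-(ζ.2 * z.2)) * ZMod.stdAddChar (-(ζ.1 * z.1)) : ℂ) *
      (ZMod.stdAddChar (-(ζ'.2 * w.2)) * ZMod.stdAddChar (-(ζ'.1 * w.1))) =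
      (ZMod.stdAddChar (-(ζ'.2 * z.2)) * ZMod.stdAddChar (-(ζ'.1 * z.1))) *
      (ZMod.stdAddChar (-(ζ.2 * w.2)) * ZMod.stdAddChar (-(ζ.1 * w.1))) := by
    refine mul_left_cancel₀ (mul_ne_zero hζ hζ') ?_
    have h4 := hzero z hz
    have h5 := hzero w hw
    linear_combination (∑ z', prodKernel p q ζ' z' * f z') * (ZMod.stdAddChar (-(ζ'.2 * w.2)) *
      ZMod.stdAddChar (-(ζ'.1 * w.1))) * h4 - (∑ z', prodKernel p q ζ' z' * f z') *
      (ZMod.stdAddChar (-(ζ'.2 * z.2)) * ZMod.stdAddChar (-(ζ'.1 * z.1))) * h5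
  have h4 : (ZMod.stdAddChar ((ζ.2 - ζ'.2) * (w.2 - z.2)) : ℂ) *
      ZMod.stdAddChar ((ζ.1 - ζ'.1) * (w.1 - z.1)) = 1 := by
    have h5 : (ζ.2 - ζ'.2) * (w.2 - z.2) =
        -(ζ.2 * z.2) + -(ζ'.2 * w.2) - (-(ζ'.2 * z.2) + -(ζ.2 * w.2)) := by ring
    have h6 : (ζ.1 - ζ'.1) * (w.1 - z.1) =
        -(ζ.1 * z.1) + -(ζ'.1 * w.1) - (-(ζ'.1 * z.1) + -(ζ.1 * w.1)) := by ring
    rw [h5, h6, AddChar.map_sub_eq_div, AddChar.map_sub_eq_div, div_mul_div_comm]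
    simp only [AddChar.map_add_eq_mul]
    rw [div_eq_one_iff_eq (by simp [addChar_ne_zero])]
    linear_combination h3
  have h5 : w.2 - z.2 = 0 := by
    -- The `p`-th power removes the `ZMod p` part and separates the two coordinates.
    have h6 := congrArg (· ^ p) h4
    simp only [mul_pow, one_pow, stdAddChar_pow_eq_one, mul_one] at h6
    rw [← AddChar.map_nsmul_eq_pow, nsmul_eq_mul,
      ← AddChar.map_zero_eq_one (ZMod.stdAddChar (N := q))] at h6
    have h7 := ZMod.injective_stdAddChar h6
    refine (mul_eq_zero.1 ((mul_eq_zero.1 h7).resolve_left ?_)).resolve_left h2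
    rw [ZMod.natCast_eq_zero_iff, Nat.prime_dvd_prime_iff_eq hq.out hp.out]
    exact hpq.symm
  rw [h5, mul_zero, AddChar.map_zero_eq_one, one_mul,
    ← AddChar.map_zero_eq_one (ZMod.stdAddChar (N := p))] at h4
  have h6 := (mul_eq_zero.1 (ZMod.injective_stdAddChar h4)).resolve_left h1
  exact (Prod.ext (sub_eq_zero.1 h6) (sub_eq_zero.1 h5)).symm

theorem hasRankOnePartition_prodKernel (hpq : p < q) {f : ZMod p × ZMod q → ℂ}
    (hf : IsExtremal (prodKernel p q) f) : HasRankOnePartition (prodKernel p q) f := by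
  have hcop : p.Coprime q := (Nat.coprime_primes hp.out hq.out).2 hpq.ne
  rcases hf.cases_of_card_lt (isChebotarev_zmodKernel p) (isChebotarev_zmodKernel q) hpq hcop
    (ZMod.card p) (ZMod.card q) (ZMod.card p) (ZMod.card q) with h | ⟨h1, h2⟩ |
    ⟨hθ2, hθp, hfst, hsnd, hlt⟩
  · exact h
  · exact absurd (eq_zero_of_injOn_snd hpq.ne h1 h2) hf.1
  · change 2 ≤ #(spec (prodKernel p q) f) at hθ2
    change #(spec (prodKernel p q) f) ≤ p at hθp
    change #(supp f) < q * (p + 2 - #(spec (prodKernel p q) f)) at hlt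
    have hz := two_mul_card_zeros_le hpq.ne hf.1 hfst hsnd
    have hcompl : #(supp f)ᶜ = p * q - #(supp f) := by
      rw [card_compl, Fintype.card_prod, ZMod.card, ZMod.card]
    have hle : #(supp f) ≤ p * q := by
      have := card_le_univ (supp f)
      rwa [Fintype.card_prod, ZMod.card, ZMod.card] at this
    -- With `θ` the size of the spectrum, `f` has more than `q(θ - 2)` zeros and at most `q(θ -
    -- 1)/2`, hence `θ < 3`.
    have hspec : #(spec (prodKernel p q) f) = 2 := by
      by_contra hne
      obtain ⟨t, ht⟩ : ∃ t, #(spec (prodKernel p q) f) = t + 3 :=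
        ⟨#(spec (prodKernel p q) f) - 3, by omega⟩
      rw [ht] at hz hlt hθp
      obtain ⟨d, hd⟩ : ∃ d, p = t + 3 + d := ⟨_, (Nat.add_sub_cancel' hθp).symm⟩
      rw [show p + 2 - (t + 3) = d + 2 by omega] at hlt
      rw [show t + 3 - 1 = t + 2 by omega] at hz
      have h1 : #(supp f)ᶜ + #(supp f) = p * q := by omega
      have h2 : p * q = (t + 3 + d) * q := congrArg (· * q) hd
      rw [h2] at h1
      nlinarith
    have h1 := card_zeros_le_one hpq.ne hspec hfst hsnd
    refine hasRankOnePartition_of_card_add_card hf.1 ?_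
    rw [hspec, Fintype.card_prod, ZMod.card, ZMod.card]
    rw [hspec, Nat.add_sub_cancel, mul_comm] at hlt
    omega

theorem hasRankOnePartition_of_addEquiv_prod_of_lt {G : Type*} [AddCommGroup G] [Fintype G]
    [DecidableEq G] [DecidableEq (AddChar G ℂ)] {f : G → ℂ} (hpq : p < q)
    (φ : G ≃+ ZMod p × ZMod q) (hf : IsExtremal (pairing G) f) :
    HasRankOnePartition (pairing G) f := by
  obtain ⟨D, hD⟩ := exists_charEquiv_prod φ
  have hK : (fun m x => pairing G (D m) (φ.symm.toEquiv x)) = prodKernel p q := by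
    funext m x
    exact hD m x
  refine HasRankOnePartition.of_comp_equiv D φ.symm.toEquiv ?_
  have := hf.comp_equiv D φ.symm.toEquiv
  rw [hK] at this ⊢
  exact hasRankOnePartition_prodKernel hpq this

end Rectangle

end FourierMatrix

theorem mainTheorem5 {G : Type*} [AddCommGroup G] [Fintype G]
    (hG : (∃ p : ℕ, p.Prime ∧ Nonempty (G ≃+ ZMod (p ^ 2))) ∨
      (∃ p : ℕ, p.Prime ∧ Nonempty (G ≃+ ZMod p × ZMod p)) ∨
      (∃ p q : ℕ, p.Prime ∧ q.Prime ∧ p ≠ q ∧ Nonempty (G ≃+ ZMod p × ZMod q)))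
    (k : ℕ) (hk : 1 ≤ k) (A : Finset G) (B : Finset (AddChar G ℂ))
    (hA : A.card = k) (hB : B.card = meshulamTheta k G)
    (hrank : (extractedFourierMatrix A B).rank ≠ k) :
    (extractedFourierMatrix A B).rank = k - 1 ∧
      (extractedFourierMatrix A B).DecomposesIntoRankOne (k - 1) := by
  classical
  refine FourierMatrix.rank_and_decomposition_of_hasRankOnePartition (fun f hf => ?_) k A B hA hB
    hrank
  rcases hG with ⟨p, hp, ⟨φ⟩⟩ | ⟨p, hp, ⟨φ⟩⟩ | ⟨p, q, hp, hq, hpq, ⟨φ⟩⟩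
  · have := Fact.mk hp
    exact FourierMatrix.hasRankOnePartition_of_addEquiv_zmod_sq φ hf
  · have := Fact.mk hp
    exact FourierMatrix.hasRankOnePartition_of_addEquiv_prod_self φ hf
  · have := Fact.mk hp
    have := Fact.mk hq
    rcases lt_or_gt_of_ne hpq with h | h
    · exact FourierMatrix.hasRankOnePartition_of_addEquiv_prod_of_lt h φ hf
    · exact FourierMatrix.hasRankOnePartition_of_addEquiv_prod_of_lt h
        (φ.trans AddEquiv.prodComm) hf
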